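/- Let $d\ge 1$ be an integer and let $\varpi\ge 2$ be real. There is a constant $C$, depending only on $d$ and $\varpi$, such that for every real $\eta$ with $0\le \frac{\eta}{d}\le\frac{\varpi}{2}-1$ the following holds. For every $x\in\mathbb{R}^d$ the oscillatory integral $$ I^{\eta}S^{\varpi}(x)=\int_{\mathbb{R}^{d}}e^{i(|\xi|^{\varpi}+x\cdot\xi)}\,|\xi|^{\eta}\,d\xi $$ exists and $$ \sup_{x\in\mathbb{R}^d}\left|I^{\eta}S^{\varpi}(x)\right|\le C . $$ Moreover, for every $t>0$ and every $x\in\mathbb{R}^d$ the oscillatory integral below exists and $$ \int_{\mathbb{R}^{d}}e^{i(t|\xi|^{\varpi}+x\cdot\xi)}\,|\xi|^{\eta}\,d\xi = t^{-\frac{d+\eta}{\varpi}}\, I^{\eta}S^{\varpi}\!\left(t^{-\frac1\varpi}x\right), \qquad \left|\int_{\mathbb{R}^{d}}e^{i(t|\xi|^{\varpi}+x\cdot\xi)}\,|\xi|^{\eta}\,d\xi\right|\le C\,t^{-\frac{d+\eta}{\varpi}} . $$ Here an oscillatory integral $\int_{\mathbb{R}^d} f(\xi)\,d\xi$ exists with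 value $z\in\mathbb{C}$ if, for every Schwartz function $\chi$ on $\mathbb{R}^d$ with $\chi(0)=1$, the integrals $\int_{\mathbb{R}^d} f(\xi)\chi(\varepsilon\xi)\,d\xi$, $\varepsilon>0$, converge absolutely and tend to $z$ as $\varepsilon\to0^+$. Furthermore, for every $t>0$ the function $K_t(x)=\int_{\mathbb{R}^{d}}e^{i(t|\xi|^{\varpi}+x\cdot\xi)}|\xi|^{\eta}\,d\xi$ obtained in this way is the inverse Fourier transform of the tempered distribution $m_t(\xi)=e^{it|\xi|^{\varpi}}|\xi|^{\eta}$, that is, $\int m_t(\xi)\left(\int e^{ix\cdot\xi}\varphi(x)\,dx\right)d\xi=\int K_t(x)\varphi(x)\,dx$ for every Schwartz function $\varphi$ on $\mathbb{R}^d$, where both outer integrals converge absolutely. -/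

import Mathlib

open MeasureTheory Filter Topology
open scoped SchwartzMap

/-- `z` is the value of the (in general not absolutely convergent) oscillatory integral
`∫_{ℝ^d} f(ξ) dξ`: for every Schwartz cutoff `χ` with `χ(0) = 1`, the regularized integrals
`∫ f(ξ) χ(εξ) dξ`, `ε > 0`, converge absolutely and tend to `z` as `ε → 0⁺`. -/
def HasOscillatoryIntegral {d : ℕ} (f : EuclideanSpace ℝ (Fin d) → ℂ) (z : ℂ) : Prop :=
  ∀ χ : 𝓢(EuclideanSpace ℝ (Fin d), ℂ), χ 0 = 1 →
    (∀ ε : ℝ, 0 < ε → Integrable (fun ξ => f ξ * χ (ε • ξ))) ∧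
    Tendsto (fun ε : ℝ => ∫ ξ, f ξ * χ (ε • ξ)) (𝓝[>] 0) (𝓝 z)

/-- The unnormalized inverse Fourier transform `(𝓕⁻¹φ)(ξ) = ∫_{ℝ^d} e^{i x·ξ} φ(x) dx`. -/
noncomputable def invFourier {d : ℕ} (φ : EuclideanSpace ℝ (Fin d) → ℂ)
    (ξ : EuclideanSpace ℝ (Fin d)) : ℂ :=
  ∫ x, Complex.exp (Complex.I * ((inner ℝ x ξ : ℝ) : ℂ)) * φ x

/-- The tempered distribution `𝓕⁻¹m`, defined by duality `⟨𝓕⁻¹m, φ⟩ = ⟨m, 𝓕⁻¹φ⟩`, is the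
function `K`. -/
def IsInvFourierTransform {d : ℕ} (m K : EuclideanSpace ℝ (Fin d) → ℂ) : Prop :=
  ∀ φ : 𝓢(EuclideanSpace ℝ (Fin d), ℂ),
    Integrable (fun ξ => m ξ * invFourier φ ξ) ∧ Integrable (fun x => K x * φ x) ∧
    ∫ ξ, m ξ * invFourier φ ξ = ∫ x, K x * φ x

/-- `K(x) = ∫_{ℝ^d} e^{i (t|ξ|^ϖ + x·ξ)} |ξ|^η dξ`, pointwise for every `x` as an oscillatory
integral, and also as an inverse Fourier transform of tempered distributions. -/
def IsDispersiveKernel (d : ℕ) (ϖ η t : ℝ) (K : EuclideanSpace ℝ (Fin d) → ℂ) : Prop :=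
  (∀ x, HasOscillatoryIntegral
    (fun ξ : EuclideanSpace ℝ (Fin d) =>
      Complex.exp (Complex.I * ((t * ‖ξ‖ ^ ϖ + inner ℝ x ξ : ℝ) : ℂ)) * ((‖ξ‖ ^ η : ℝ) : ℂ))
    (K x)) ∧
  IsInvFourierTransform
    (fun ξ : EuclideanSpace ℝ (Fin d) =>
      Complex.exp (Complex.I * ((t * ‖ξ‖ ^ ϖ : ℝ) : ℂ)) * ((‖ξ‖ ^ η : ℝ) : ℂ))
    K

/-!
Decompose frequency space into the ball `‖ξ‖ ≤ 2` and dyadic annuli `‖ξ‖ ~ R = 2 ^ (j + 1)`. Scaling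
an annulus to unit size turns its contribution into `R ^ (d + η)` times an integral with large
parameter `λ = R ^ ϖ` and phase `‖ξ‖ ^ ϖ + y · ξ`, `y = R ^ (1 - ϖ) x`.

* Uniformly in `y` this integral is `O(λ ^ (-d/2))`: its square is the Fourier transform of a
  correlation in `h`, whose phase `(‖ξ + h‖ ^ ϖ - ‖ξ‖ ^ ϖ) / ‖h‖` has slope bounded below in the
  direction of `h`, so that nonstationary phase bounds the correlation by `O((1 + λ‖h‖) ^ (-d-1))`.
  The upper bound on `η` says exactly that `λ ^ (-d/2) R ^ (d + η) ≤ 1`.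
* For all but at most four `j`, depending on `x`, the phase has no critical point on the annulus,
  and nonstationary phase gives `O(1/R)`.

Hence the sum over the annuli is bounded. All constants are uniform because the phases and
amplitudes depend smoothly on parameters in a compact set. The sum is the inverse Fourier transform
of the symbol by duality, and pairing it with an approximate identity evaluates the oscillatory
integral. A dilation passes from time `1` to time `t`.
-/

open scoped ContDiff

/-! ### Nonstationary phase -/

/-- The unit complex number `e^{iu}`. -/
noncomputable def expI (u : ℝ) : ℂ := Complex.exp (Complex.I * (u : ℂ))

theorem norm_expI (u : ℝ) : ‖expI u‖ = 1 := by
  rw [expI, mul_comm, Complex.norm_exp_ofReal_mul_I]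

theorem expI_add (u v : ℝ) : expI (u + v) = expI u * expI v := by
  simp only [expI, Complex.ofReal_add, mul_add, Complex.exp_add]

theorem star_expI (u : ℝ) : star (expI u) = expI (-u) := by
  rw [expI, expI, Complex.star_def, ← Complex.exp_conj]
  simp

theorem contDiff_expI : ContDiff ℝ ∞ expI :=
  Complex.contDiff_exp.comp (contDiff_const.mul Complex.ofRealCLM.contDiff)

theorem hasDerivAt_expI (u : ℝ) : HasDerivAt expI (expI u * Complex.I) u := by
  have h : HasDerivAt (fun v : ℝ => Complex.I * (v : ℂ)) Complex.I u := by
    simpa using (hasDerivAt_id u).ofReal_comp.const_mul Complex.I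
  exact h.cexp

theorem contDiff_intervalIntegral_param {P : Type*} [NormedAddCommGroup P] [NormedSpace ℝ P]
    {F : P × ℝ → ℝ} (hF : ContDiff ℝ ∞ F) :
    ContDiff ℝ ∞ (fun p => ∫ s in (0 : ℝ)..1, F (p, s)) := by
  -- The integral is the value at `0` of the convolution of the indicator of `(0, 1]` with
  -- `s ↦ b s * F (p, -s)`, where the bump function `b` only serves to make the second factor
  -- compactly supported.
  let b : ContDiffBump (0 : ℝ) := ⟨1, 2, one_pos, one_lt_two⟩
  have hind : LocallyIntegrable ((Set.Ioc (0 : ℝ) 1).indicator 1 : ℝ → ℝ) :=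
    ((integrable_indicator_iff measurableSet_Ioc).2
      (integrableOn_const (by simp))).locallyIntegrable
  have hsmooth : ContDiff ℝ ∞ (fun q : P × ℝ => b q.2 * F (q.1, -q.2)) :=
    (b.contDiff.comp contDiff_snd).mul (hF.comp (contDiff_fst.prodMk contDiff_snd.neg))
  have hsupp : ∀ (p : P) (s : ℝ), p ∈ Set.univ → s ∉ Metric.closedBall 0 2 →
      b s * F (p, -s) = 0 := fun p s _ hs => by
    rw [Metric.mem_closedBall, not_le] at hs
    rw [b.zero_of_le_dist hs.le, zero_mul]
  have hconv := contDiffOn_convolution_right_with_param_comp (n := ⊤) (μ := volume)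
    (ContinuousLinearMap.mul ℝ ℝ) (v := fun _ => (0 : ℝ)) contDiffOn_const
    (g := fun p s => b s * F (p, -s)) isOpen_univ (isCompact_closedBall _ _) hsupp hind
    hsmooth.contDiffOn
  rw [contDiffOn_univ] at hconv
  convert hconv using 2 with p
  rw [convolution_def, intervalIntegral.integral_of_le zero_le_one,
    ← integral_indicator measurableSet_Ioc]
  congr 1 with s
  by_cases hs : s ∈ Set.Ioc (0 : ℝ) 1
  · have hb : b (-s) = 1 := b.one_of_mem_closedBall (by simpa [b, abs_of_pos hs.1] using hs.2)
    simp [Set.indicator_of_mem hs, hb]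
  · simp [Set.indicator_of_notMem hs]

/-- A smooth function on `ℝ` that agrees with the inverse on `[c, ∞)`. -/
noncomputable def smoothInv (c u : ℝ) : ℝ := Real.smoothTransition (2 * u / c - 1) * u⁻¹

theorem smoothInv_of_le {c u : ℝ} (hc : 0 < c) (h : c ≤ u) : smoothInv c u = u⁻¹ := by
  have : 1 ≤ 2 * u / c - 1 := by
    rw [le_sub_iff_add_le, le_div_iff₀ hc]; linarith
  rw [smoothInv, Real.smoothTransition.one_of_one_le this, one_mul]

theorem contDiff_smoothInv (c : ℝ) : ContDiff ℝ ∞ (smoothInv c) := by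
  have harg : ContDiff ℝ ∞ fun v : ℝ => 2 * v / c - 1 := by fun_prop
  rw [contDiff_iff_contDiffAt]
  intro u
  rcases eq_or_ne u 0 with rfl | hu
  · have hzero : smoothInv c =ᶠ[𝓝 0] fun _ => 0 := by
      filter_upwards [harg.continuous.continuousAt.eventually_lt_const
        (show 2 * 0 / c - 1 < 0 by simp)] with v hv
      rw [smoothInv, Real.smoothTransition.zero_of_nonpos hv.le, zero_mul]
    exact contDiffAt_const.congr_of_eventuallyEq hzero
  · exact (Real.smoothTransition.contDiff.comp harg).contDiffAt.mul (contDiffAt_inv ℝ hu)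

section NonstationaryPhase

variable {P V F : Type*} [NormedAddCommGroup P] [NormedSpace ℝ P] [NormedAddCommGroup V]
  [NormedSpace ℝ V] [NormedAddCommGroup F] [NormedSpace ℝ F]

/-- The derivative of a function of two variables in its second variable. -/
noncomputable def derivSnd (f : P × V → F) (q : P × V) : V →L[ℝ] F :=
  fderiv ℝ f q ∘L .inr ℝ P V

theorem contDiff_derivSnd {f : P × V → F} (hf : ContDiff ℝ ∞ f) : ContDiff ℝ ∞ (derivSnd f) :=
  (hf.fderiv_right (m := ∞) (by simp)).clm_comp contDiff_const

theorem contDiff_derivSnd_apply {Φ : P × V → F} {W : P × V → V} (hΦ : ContDiff ℝ ∞ Φ)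
    (hW : ContDiff ℝ ∞ W) : ContDiff ℝ ∞ fun q => derivSnd Φ q (W q) :=
  (contDiff_derivSnd hΦ).clm_apply hW

theorem hasFDerivAt_slice {f : P × V → F} (hf : ContDiff ℝ ∞ f) (p : P) (ξ : V) :
    HasFDerivAt (fun ζ => f (p, ζ)) (derivSnd f (p, ξ)) ξ :=
  (hf.differentiable (by simp) (p, ξ)).hasFDerivAt.comp ξ (hasFDerivAt_prodMk_right p ξ)

theorem derivSnd_eq_fderiv {f : P × V → F} (hf : ContDiff ℝ ∞ f) (p : P) (ξ : V) :
    derivSnd f (p, ξ) = fderiv ℝ (fun ζ => f (p, ζ)) ξ :=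
  (hasFDerivAt_slice hf p ξ).fderiv.symm

theorem derivSnd_eq_zero_of_notMem {f : P × V → F} (hf : ContDiff ℝ ∞ f) {S : Set V}
    (hS : IsClosed S) {p : P} (hfS : ∀ ξ ∉ S, f (p, ξ) = 0) {ξ : V} (hξ : ξ ∉ S) :
    derivSnd f (p, ξ) = 0 := by
  have hzero : (fun ζ => f (p, ζ)) =ᶠ[𝓝 ξ] fun _ => 0 := by
    filter_upwards [hS.isOpen_compl.mem_nhds hξ] with ζ hζ using hfS ζ hζ
  rw [derivSnd_eq_fderiv hf, hzero.fderiv_eq, fderiv_const_apply]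

/-- The vector field `W / (W·∇Φ)`, smoothly modified where `W·∇Φ < c`. Where `c ≤ W·∇Φ`, the phase
`Φ` grows with unit speed along it. -/
noncomputable def unitSpeedField (c : ℝ) (Φ : P × V → ℝ) (W : P × V → V) (q : P × V) : V :=
  smoothInv c (derivSnd Φ q (W q)) • W q

/-- The points of the ball of radius `R` at which the phase `Φ (p, ·)` increases at rate at least
`c` in the direction `W`. -/
def nonstationarySet (c R : ℝ) (Φ : P × V → ℝ) (W : P × V → V) (p : P) : Set V :=
  {ξ | ‖ξ‖ ≤ R ∧ c ≤ derivSnd Φ (p, ξ) (W (p, ξ))}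

section

variable {c : ℝ} {Φ : P × V → ℝ} {W : P × V → V}

theorem contDiff_smul_unitSpeedField (c : ℝ) (hΦ : ContDiff ℝ ∞ Φ) (hW : ContDiff ℝ ∞ W)
    {f : P × V → ℝ} (hf : ContDiff ℝ ∞ f) :
    ContDiff ℝ ∞ fun q => f q • unitSpeedField c Φ W q :=
  hf.smul (((contDiff_smoothInv c).comp (contDiff_derivSnd_apply hΦ hW)).smul hW)

theorem derivSnd_unitSpeedField (hc : 0 < c) {R : ℝ} {p : P} {ξ : V}
    (hξ : ξ ∈ nonstationarySet c R Φ W p) :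
    derivSnd Φ (p, ξ) (unitSpeedField c Φ W (p, ξ)) = 1 := by
  rw [unitSpeedField, smoothInv_of_le hc hξ.2, map_smul, smul_eq_mul,
    inv_mul_cancel₀ (hc.trans_le hξ.2).ne']

theorem isClosed_nonstationarySet (c R : ℝ) (hΦ : ContDiff ℝ ∞ Φ) (hW : ContDiff ℝ ∞ W) (p : P) :
    IsClosed (nonstationarySet c R Φ W p) :=
  (isClosed_le continuous_norm continuous_const).inter
    (isClosed_le continuous_const
      ((contDiff_derivSnd_apply hΦ hW).continuous.comp (Continuous.prodMk_right p)))

end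

variable [FiniteDimensional ℝ V]

/-- The trace of endomorphisms of a finite-dimensional space as a continuous linear form; its
value on the derivative of a vector field is the divergence of the field. -/
noncomputable def traceCLM (V : Type*) [NormedAddCommGroup V] [NormedSpace ℝ V]
    [FiniteDimensional ℝ V] : (V →L[ℝ] V) →L[ℝ] ℝ :=
  LinearMap.toContinuousLinearMap (LinearMap.trace ℝ V ∘ₗ ContinuousLinearMap.coeLM ℝ)

theorem traceCLM_apply_eq_sum {ι : Type*} [Fintype ι] (b : Module.Basis ι ℝ V) (T : V →L[ℝ] V) :
    traceCLM V T = ∑ i, b.coord i (T (b i)) := by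
  classical
  simp [traceCLM, LinearMap.trace_eq_matrix_trace ℝ b, Matrix.trace, LinearMap.toMatrix_apply]

/-- The amplitude `div (f X)`, where `X` is the `unitSpeedField`, produced up to the factor `i/λ` by
one integration by parts of `∫ e^{iλΦ} f`. -/
noncomputable def adjointAmp (c : ℝ) (Φ : P × V → ℝ) (W : P × V → V) (f : P × V → ℝ)
    (q : P × V) : ℝ :=
  traceCLM V (derivSnd (fun q => f q • unitSpeedField c Φ W q) q)

variable {c R : ℝ} {Φ : P × V → ℝ} {W : P × V → V} {f : P × V → ℝ}

theorem contDiff_adjointAmp (c : ℝ) (hΦ : ContDiff ℝ ∞ Φ) (hW : ContDiff ℝ ∞ W)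
    (hf : ContDiff ℝ ∞ f) : ContDiff ℝ ∞ (adjointAmp c Φ W f) :=
  (traceCLM V).contDiff.comp (contDiff_derivSnd (contDiff_smul_unitSpeedField c hΦ hW hf))

theorem adjointAmp_eq_zero_of_notMem (hΦ : ContDiff ℝ ∞ Φ) (hW : ContDiff ℝ ∞ W)
    (hf : ContDiff ℝ ∞ f) {p : P} (hsupp : ∀ ξ ∉ nonstationarySet c R Φ W p, f (p, ξ) = 0)
    {ξ : V} (hξ : ξ ∉ nonstationarySet c R Φ W p) : adjointAmp c Φ W f (p, ξ) = 0 := by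
  rw [adjointAmp, derivSnd_eq_zero_of_notMem (contDiff_smul_unitSpeedField c hΦ hW hf)
    (isClosed_nonstationarySet c R hΦ hW p) (fun ζ hζ => by rw [hsupp ζ hζ, zero_smul]) hξ,
    map_zero]

variable [MeasurableSpace V] [BorelSpace V] (μ : Measure V) [μ.IsAddHaarMeasure]

theorem integral_fderiv_apply_eq_neg_integral_trace {u : V → F} {Y : V → V} (hu : ContDiff ℝ 1 u)
    (hY : ContDiff ℝ 1 Y) (hYc : HasCompactSupport Y) :
    ∫ ξ, fderiv ℝ u ξ (Y ξ) ∂μ = -∫ ξ, traceCLM V (fderiv ℝ Y ξ) • u ξ ∂μ := by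
  let b := Module.finBasis ℝ V
  let coord i : V →L[ℝ] ℝ := LinearMap.toContinuousLinearMap (b.coord i)
  let y i ξ := coord i (Y ξ)
  have hy i : ContDiff ℝ 1 (y i) := (coord i).contDiff.comp hY
  have hyc i : HasCompactSupport (y i) := hYc.comp_left (map_zero _)
  have hdy i : HasCompactSupport fun ξ => fderiv ℝ (y i) ξ (b i) := (hyc i).fderiv_apply ℝ (b i)
  have hdu i : Continuous fun ξ => fderiv ℝ u ξ (b i) :=
    (hu.continuous_fderiv one_ne_zero).clm_apply continuous_const
  have hdy' i : Continuous fun ξ => fderiv ℝ (y i) ξ (b i) :=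
    ((hy i).continuous_fderiv one_ne_zero).clm_apply continuous_const
  have hint i : Integrable (fun ξ => y i ξ • fderiv ℝ u ξ (b i)) μ :=
    ((hy i).continuous.smul (hdu i)).integrable_of_hasCompactSupport (hyc i).smul_right
  have hint' i : Integrable (fun ξ => fderiv ℝ (y i) ξ (b i) • u ξ) μ :=
    ((hdy' i).smul hu.continuous).integrable_of_hasCompactSupport (hdy i).smul_right
  have hparts i : ∫ ξ, y i ξ • fderiv ℝ u ξ (b i) ∂μ = -∫ ξ, fderiv ℝ (y i) ξ (b i) • u ξ ∂μ :=
    integral_smul_fderiv_eq_neg_fderiv_smul_of_integrable (hint' i) (hint i)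
      (((hy i).continuous.smul hu.continuous).integrable_of_hasCompactSupport (hyc i).smul_right)
      (fun ξ _ => (hy i).differentiable one_ne_zero ξ)
      (fun ξ _ => hu.differentiable one_ne_zero ξ)
  calc ∫ ξ, fderiv ℝ u ξ (Y ξ) ∂μ = ∑ i, ∫ ξ, y i ξ • fderiv ℝ u ξ (b i) ∂μ := by
        rw [← integral_finsetSum _ fun i _ => hint i]
        refine integral_congr_ae (.of_forall fun ξ => ?_)
        have hrepr := congrArg (fderiv ℝ u ξ) (b.sum_repr (Y ξ))
        rw [map_sum] at hrepr
        simp only [map_smul] at hrepr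
        exact hrepr.symm
    _ = -∑ i, ∫ ξ, fderiv ℝ (y i) ξ (b i) • u ξ ∂μ := by
        simp only [hparts, Finset.sum_neg_distrib]
    _ = -∫ ξ, traceCLM V (fderiv ℝ Y ξ) • u ξ ∂μ := by
        rw [← integral_finsetSum _ fun i _ => hint' i]
        congr 2 with ξ
        have hcomp i : fderiv ℝ (y i) ξ = coord i ∘L fderiv ℝ Y ξ :=
          ((coord i).hasFDerivAt.comp ξ (hY.differentiable one_ne_zero ξ).hasFDerivAt).fderiv
        simp only [hcomp, traceCLM_apply_eq_sum b, Finset.sum_smul]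
        rfl

theorem integral_expI_mul_eq_integral_adjointAmp (hc : 0 < c) (hΦ : ContDiff ℝ ∞ Φ)
    (hW : ContDiff ℝ ∞ W) (hf : ContDiff ℝ ∞ f) {p : P}
    (hsupp : ∀ ξ ∉ nonstationarySet c R Φ W p, f (p, ξ) = 0) {lam : ℝ} (hlam : 0 < lam) :
    ∫ ξ, expI (lam * Φ (p, ξ)) * f (p, ξ) ∂μ =
      Complex.I / lam * ∫ ξ, expI (lam * Φ (p, ξ)) * adjointAmp c Φ W f (p, ξ) ∂μ := by
  let Y ξ := f (p, ξ) • unitSpeedField c Φ W (p, ξ)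
  let u ξ := expI (lam * Φ (p, ξ))
  have hslice : ContDiff ℝ ∞ fun ξ : V => (p, ξ) := contDiff_prodMk_right p
  have hfield := contDiff_smul_unitSpeedField c hΦ hW hf
  have hY : ContDiff ℝ 1 Y := (hfield.comp hslice).of_le (by simp)
  have hYc : HasCompactSupport Y := .intro (isCompact_closedBall 0 R) fun ξ hξ => by
    simp only [Y, hsupp ξ fun h => hξ (by simpa using h.1), zero_smul]
  have hu : ContDiff ℝ 1 u :=
    (contDiff_expI.comp (contDiff_const.mul (hΦ.comp hslice))).of_le (by simp)
  have hdu ξ : fderiv ℝ u ξ (Y ξ) = Complex.I * lam * (u ξ * f (p, ξ)) := by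
    have hderiv : HasFDerivAt u _ ξ := (hasDerivAt_expI _).hasFDerivAt.comp ξ
      ((hasFDerivAt_slice hΦ p ξ).const_mul lam)
    rw [hderiv.fderiv]
    by_cases hξ : ξ ∈ nonstationarySet c R Φ W p
    · simp only [Y, u, ContinuousLinearMap.comp_smulₛₗ, Real.ringHom_apply, map_smul, smul_apply,
        ContinuousLinearMap.comp_apply, derivSnd_unitSpeedField hc hξ,
        ContinuousLinearMap.toSpanSingleton_apply, one_smul, Complex.real_smul]
      ring
    · simp [Y, hsupp ξ hξ]
  have hdY ξ : traceCLM V (fderiv ℝ Y ξ) • u ξ = u ξ * adjointAmp c Φ W f (p, ξ) := by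
    rw [adjointAmp, derivSnd_eq_fderiv hfield, Complex.real_smul, mul_comm]
  have hparts := integral_fderiv_apply_eq_neg_integral_trace μ hu hY hYc
  simp only [hdu, hdY, integral_const_mul] at hparts
  have hlam' : (lam : ℂ) ≠ 0 := by exact_mod_cast hlam.ne'
  rw [← neg_eq_iff_eq_neg] at hparts
  rw [← hparts]
  field_simp
  rw [Complex.I_sq]
  ring

theorem exists_nonstationary_phase_bound (hc : 0 < c) (R : ℝ) (hΦ : ContDiff ℝ ∞ Φ)
    (hW : ContDiff ℝ ∞ W) (hf : ContDiff ℝ ∞ f) {K : Set P} (hK : IsCompact K) (N : ℕ) :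
    ∃ C : ℝ, 0 ≤ C ∧ ∀ p ∈ K, (∀ ξ ∉ nonstationarySet c R Φ W p, f (p, ξ) = 0) →
      ∀ lam : ℝ, 0 < lam → ‖∫ ξ, expI (lam * Φ (p, ξ)) * f (p, ξ) ∂μ‖ ≤ C * lam⁻¹ ^ N := by
  induction N generalizing f with
  | zero =>
    obtain ⟨M, hM⟩ := (hK.prod (isCompact_closedBall (0 : V) R)).exists_bound_of_continuousOn
      hf.continuous.continuousOn
    refine ⟨|M| * μ.real (Metric.closedBall 0 R), by positivity, fun p hp hsupp lam _ => ?_⟩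
    have hball : ∀ ξ ∉ Metric.closedBall (0 : V) R, expI (lam * Φ (p, ξ)) * f (p, ξ) = 0 :=
      fun ξ hξ => by rw [hsupp ξ fun h => hξ (by simpa using h.1), Complex.ofReal_zero, mul_zero]
    rw [← setIntegral_eq_integral_of_forall_compl_eq_zero hball, pow_zero, mul_one]
    refine norm_setIntegral_le_of_norm_le_const measure_closedBall_lt_top fun ξ hξ => ?_
    rw [norm_mul, norm_expI, one_mul, Complex.norm_real]
    exact (hM (p, ξ) ⟨hp, hξ⟩).trans (le_abs_self M)
  | succ N ih =>
    obtain ⟨C, hC, hbound⟩ := ih (contDiff_adjointAmp c hΦ hW hf)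
    refine ⟨C, hC, fun p hp hsupp lam hlam => ?_⟩
    have hnorm : ‖Complex.I / (lam : ℂ)‖ = lam⁻¹ := by
      rw [norm_div, Complex.norm_I, Complex.norm_real, Real.norm_of_nonneg hlam.le, one_div]
    rw [integral_expI_mul_eq_integral_adjointAmp μ hc hΦ hW hf hsupp hlam, norm_mul, hnorm]
    calc lam⁻¹ * _ ≤ lam⁻¹ * (C * lam⁻¹ ^ N) := by
          gcongr
          exact hbound p hp (fun ξ hξ => adjointAmp_eq_zero_of_notMem hΦ hW hf hsupp hξ) lam hlam
      _ = C * lam⁻¹ ^ (N + 1) := by ring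

end NonstationaryPhase

/-! ### Integrals over the unit annulus -/

section Annulus

variable {V : Type*} [NormedAddCommGroup V]

/-- A smooth function that agrees with `log ‖ξ‖` for `1/4 ≤ ‖ξ‖`. -/
noncomputable def smoothLog (ξ : V) : ℝ :=
  Real.smoothTransition (32 * ‖ξ‖ ^ 2 - 1) * Real.log ‖ξ‖

theorem smoothLog_of_le {ξ : V} (h : 1 / 4 ≤ ‖ξ‖) : smoothLog ξ = Real.log ‖ξ‖ := by
  rw [smoothLog, Real.smoothTransition.one_of_one_le (by nlinarith), one_mul]

/-- A smooth function that agrees with `‖ξ‖ ^ ϖ` for `1/4 ≤ ‖ξ‖`. -/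
noncomputable def smoothPow (ϖ : ℝ) (ξ : V) : ℝ :=
  Real.exp (ϖ * smoothLog ξ)

theorem smoothPow_of_le (ϖ : ℝ) {ξ : V} (h : 1 / 4 ≤ ‖ξ‖) : smoothPow ϖ ξ = ‖ξ‖ ^ ϖ := by
  rw [smoothPow, smoothLog_of_le h, Real.rpow_def_of_pos (by linarith), mul_comm]

variable [InnerProductSpace ℝ V] {X : Type*} [NormedAddCommGroup X] [NormedSpace ℝ X]

theorem contDiff_smoothLog : ContDiff ℝ ∞ (smoothLog : V → ℝ) := by
  have harg : ContDiff ℝ ∞ fun ζ : V => 32 * ‖ζ‖ ^ 2 - 1 :=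
    (contDiff_const.mul (contDiff_norm_sq ℝ)).sub contDiff_const
  rw [contDiff_iff_contDiffAt]
  intro ξ
  rcases eq_or_ne ξ 0 with rfl | hξ
  · have hzero : smoothLog =ᶠ[𝓝 (0 : V)] fun _ => 0 := by
      filter_upwards [harg.continuous.continuousAt.eventually_lt_const
        (show 32 * ‖(0 : V)‖ ^ 2 - 1 < 0 by simp)] with ζ hζ
      rw [smoothLog, Real.smoothTransition.zero_of_nonpos hζ.le, zero_mul]
    exact contDiffAt_const.congr_of_eventuallyEq hzero
  · exact (Real.smoothTransition.contDiff.comp harg).contDiffAt.mul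
      ((contDiffAt_norm ℝ hξ).log (norm_ne_zero_iff.2 hξ))

theorem contDiff_smoothPow {a : X → ℝ} {b : X → V} (ha : ContDiff ℝ ∞ a) (hb : ContDiff ℝ ∞ b) :
    ContDiff ℝ ∞ fun x => smoothPow (a x) (b x) :=
  (ha.mul (contDiff_smoothLog.comp hb)).exp

theorem contDiff_smoothPow_const (ϖ : ℝ) : ContDiff ℝ ∞ (smoothPow ϖ : V → ℝ) :=
  contDiff_smoothPow contDiff_const contDiff_id

theorem differentiable_smoothPow_const (ϖ : ℝ) : Differentiable ℝ (smoothPow ϖ : V → ℝ) :=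
  (contDiff_smoothPow_const ϖ).differentiable (by simp)

theorem fderiv_smoothPow {ϖ : ℝ} (hϖ : 1 < ϖ) {ξ : V} (h : 1 / 4 < ‖ξ‖) (v : V) :
    fderiv ℝ (smoothPow ϖ) ξ v = ϖ * ‖ξ‖ ^ (ϖ - 2) * inner ℝ ξ v := by
  have hpow : smoothPow ϖ =ᶠ[𝓝 ξ] fun ζ => ‖ζ‖ ^ ϖ := by
    filter_upwards [continuous_norm.continuousAt.eventually_const_lt h] with ζ hζ
      using smoothPow_of_le ϖ hζ.le
  rw [hpow.fderiv_eq, (hasFDerivAt_norm_rpow ξ hϖ).fderiv]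
  simp

theorem le_inner_rpow_sub {ϖ m : ℝ} (hϖ : 2 ≤ ϖ) (hm : 0 ≤ m) {a b : V} (ha : m ≤ ‖a‖)
    (hb : m ≤ ‖b‖) :
    m ^ (ϖ - 2) * ‖b - a‖ ^ 2 ≤
      ‖b‖ ^ (ϖ - 2) * inner ℝ b (b - a) - ‖a‖ ^ (ϖ - 2) * inner ℝ a (b - a) := by
  have hα : m ^ (ϖ - 2) ≤ ‖a‖ ^ (ϖ - 2) := Real.rpow_le_rpow hm ha (by linarith)
  have hβ : m ^ (ϖ - 2) ≤ ‖b‖ ^ (ϖ - 2) := Real.rpow_le_rpow hm hb (by linarith)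
  have hmono : 0 ≤ (‖b‖ ^ (ϖ - 2) - ‖a‖ ^ (ϖ - 2)) * (‖b‖ ^ 2 - ‖a‖ ^ 2) := by
    rcases le_total ‖a‖ ‖b‖ with h | h
    · exact mul_nonneg (sub_nonneg.2 (Real.rpow_le_rpow (norm_nonneg _) h (by linarith)))
        (sub_nonneg.2 (by gcongr))
    · exact mul_nonneg_of_nonpos_of_nonpos
        (sub_nonpos.2 (Real.rpow_le_rpow (norm_nonneg _) h (by linarith)))
        (sub_nonpos.2 (by gcongr))
  have hb_inner : inner ℝ b (b - a) = ‖b‖ ^ 2 - inner ℝ b a := by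
    rw [inner_sub_right, real_inner_self_eq_norm_sq]
  have ha_inner : inner ℝ a (b - a) = inner ℝ b a - ‖a‖ ^ 2 := by
    rw [inner_sub_right, real_inner_self_eq_norm_sq, real_inner_comm]
  have hsq : 0 ≤ ‖b - a‖ ^ 2 := sq_nonneg _
  rw [norm_sub_sq_real] at hsq
  rw [ha_inner, hb_inner, norm_sub_sq_real]
  nlinarith [mul_le_mul_of_nonneg_right hα hsq, mul_le_mul_of_nonneg_right hβ hsq]

/-- The difference quotient `(‖ξ + r e‖ ^ ϖ - ‖ξ‖ ^ ϖ) / r`, written as an integral so that it is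
smooth up to `r = 0`. -/
noncomputable def phaseQuotient (ϖ r : ℝ) (e ξ : V) : ℝ :=
  ∫ s in (0 : ℝ)..1, fderiv ℝ (smoothPow ϖ) (ξ + (s * r) • e) e

theorem contDiff_phaseQuotient (ϖ : ℝ) {r : X → ℝ} {e ξ : X → V} (hr : ContDiff ℝ ∞ r)
    (he : ContDiff ℝ ∞ e) (hξ : ContDiff ℝ ∞ ξ) :
    ContDiff ℝ ∞ fun x => phaseQuotient ϖ (r x) (e x) (ξ x) := by
  have hderiv : ContDiff ℝ ∞ (fderiv ℝ (smoothPow ϖ : V → ℝ)) :=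
    (contDiff_smoothPow_const ϖ).fderiv_right (by simp)
  refine contDiff_intervalIntegral_param (P := X) (F := fun z =>
    fderiv ℝ (smoothPow ϖ) (ξ z.1 + (z.2 * r z.1) • e z.1) (e z.1)) ?_
  exact (hderiv.comp (by fun_prop)).clm_apply (by fun_prop)

theorem mul_phaseQuotient (ϖ r : ℝ) (e ξ : V) :
    r * phaseQuotient ϖ r e ξ = smoothPow ϖ (ξ + r • e) - smoothPow ϖ ξ := by
  have hline (s : ℝ) : HasDerivAt (fun s : ℝ => ξ + (s * r) • e) (r • e) s := by
    simpa using (((hasDerivAt_id s).mul_const r).smul_const e).const_add ξ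
  have hderiv (s : ℝ) : HasDerivAt (fun s : ℝ => smoothPow ϖ (ξ + (s * r) • e))
      (r * fderiv ℝ (smoothPow ϖ) (ξ + (s * r) • e) e) s := by
    have h := (differentiable_smoothPow_const ϖ _).hasFDerivAt.comp_hasDerivAt s (hline s)
    rwa [map_smul, smul_eq_mul] at h
  have hcont : Continuous fun s : ℝ => r * fderiv ℝ (smoothPow ϖ) (ξ + (s * r) • e) e :=
    continuous_const.mul ((((contDiff_smoothPow_const ϖ).continuous_fderiv (by simp)).comp
      (by fun_prop)).clm_apply continuous_const)
  rw [phaseQuotient, ← intervalIntegral.integral_const_mul,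
    intervalIntegral.integral_eq_sub_of_hasDerivAt (fun s _ => hderiv s)
      (hcont.intervalIntegrable 0 1)]
  simp

theorem mul_fderiv_phaseQuotient (ϖ r : ℝ) (e ξ v : V) :
    r * fderiv ℝ (phaseQuotient ϖ r e) ξ v =
      fderiv ℝ (smoothPow ϖ) (ξ + r • e) v - fderiv ℝ (smoothPow ϖ) ξ v := by
  have hquot : DifferentiableAt ℝ (phaseQuotient ϖ r e) ξ :=
    (contDiff_phaseQuotient ϖ contDiff_const contDiff_const contDiff_id).differentiable (by simp) ξ
  have hpow := differentiable_smoothPow_const (V := V) ϖ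
  have hshift : DifferentiableAt ℝ (fun ζ => smoothPow ϖ (ζ + r • e)) ξ :=
    (differentiableAt_comp_add_right _).2 (hpow (ξ + r • e))
  have h := congrArg (fun F : V → ℝ => fderiv ℝ F ξ v) (funext (mul_phaseQuotient ϖ r e))
  simpa [fderiv_const_mul hquot, fderiv_fun_sub hshift (hpow ξ), fderiv_comp_add_right] using h

theorem le_fderiv_phaseQuotient {ϖ m r : ℝ} (hϖ : 2 ≤ ϖ) (hr : 0 < r) {e ξ : V} (he : ‖e‖ = 1)
    (hm : 1 / 4 < m) (hξ : m ≤ ‖ξ‖) (hξr : m ≤ ‖ξ + r • e‖) :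
    ϖ * m ^ (ϖ - 2) ≤ fderiv ℝ (phaseQuotient ϖ r e) ξ e := by
  have hmono := le_inner_rpow_sub hϖ (by linarith) hξ hξr
  rw [add_sub_cancel_left, inner_smul_right, inner_smul_right, norm_smul, he, mul_one,
    Real.norm_of_nonneg hr.le] at hmono
  have hderiv := mul_fderiv_phaseQuotient ϖ r e ξ e
  rw [fderiv_smoothPow (by linarith) (by linarith), fderiv_smoothPow (by linarith) (by linarith)]
    at hderiv
  refine le_of_mul_le_mul_left ?_ (pow_pos hr 2)
  rw [pow_two r, mul_assoc r r (fderiv _ _ _ _), hderiv]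
  nlinarith [mul_le_mul_of_nonneg_left hmono (by linarith : (0 : ℝ) ≤ ϖ)]

variable [FiniteDimensional ℝ V]

/-- A smooth cutoff: `1` on the unit ball and `0` off the ball of radius `2`. -/
noncomputable def ballCutoff (V : Type*) [NormedAddCommGroup V] [InnerProductSpace ℝ V] :
    ContDiffBump (0 : V) :=
  ⟨1, 2, one_pos, one_lt_two⟩

theorem ballCutoff_of_le {ξ : V} (h : ‖ξ‖ ≤ 1) : ballCutoff V ξ = 1 :=
  (ballCutoff V).one_of_mem_closedBall (by simpa [ballCutoff] using h)

theorem ballCutoff_of_ge {ξ : V} (h : 2 ≤ ‖ξ‖) : ballCutoff V ξ = 0 :=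
  (ballCutoff V).zero_of_le_dist (by simpa [ballCutoff] using h)

/-- The dyadic cutoff to the annulus `1/2 < ‖ξ‖ < 2`. -/
noncomputable def annulusCutoff (ξ : V) : ℝ :=
  ballCutoff V ξ - ballCutoff V ((2 : ℝ) • ξ)

theorem contDiff_annulusCutoff : ContDiff ℝ ∞ (annulusCutoff : V → ℝ) :=
  (ballCutoff V).contDiff.sub ((ballCutoff V).contDiff.comp (contDiff_const_smul _))

theorem annulusCutoff_of_le {ξ : V} (h : ‖ξ‖ ≤ 1 / 2) : annulusCutoff ξ = 0 := by
  rw [annulusCutoff, ballCutoff_of_le (by linarith), ballCutoff_of_le, sub_self]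
  rw [norm_smul, Real.norm_ofNat]; linarith

theorem annulusCutoff_of_ge {ξ : V} (h : 2 ≤ ‖ξ‖) : annulusCutoff ξ = 0 := by
  rw [annulusCutoff, ballCutoff_of_ge h, ballCutoff_of_ge, sub_self]
  rw [norm_smul, Real.norm_ofNat]; linarith

/-- The amplitude `‖ξ‖ ^ η` localized to the annulus `1/2 < ‖ξ‖ < 2`. -/
noncomputable def annulusAmp (η : ℝ) (ξ : V) : ℝ := annulusCutoff ξ * smoothPow η ξ

theorem contDiff_annulusAmp {a : X → ℝ} {b : X → V} (ha : ContDiff ℝ ∞ a)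
    (hb : ContDiff ℝ ∞ b) : ContDiff ℝ ∞ fun x => annulusAmp (a x) (b x) :=
  (contDiff_annulusCutoff.comp hb).mul (contDiff_smoothPow ha hb)

theorem norm_mem_of_annulusAmp_ne_zero {η : ℝ} {ξ : V} (h : annulusAmp η ξ ≠ 0) :
    1 / 2 < ‖ξ‖ ∧ ‖ξ‖ < 2 := by
  constructor <;> by_contra! h'
  · exact h (by rw [annulusAmp, annulusCutoff_of_le h', zero_mul])
  · exact h (by rw [annulusAmp, annulusCutoff_of_ge h', zero_mul])

end Annulus

section StationaryPhase

theorem integral_mul_star_integral {G : Type*} [AddGroup G] [MeasurableSpace G]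
    [MeasurableAdd₂ G] [MeasurableNeg G] (μ : Measure G) [SFinite μ] [μ.IsAddLeftInvariant]
    {f : G → ℂ} (hf : Integrable f μ) :
    (∫ ξ, f ξ ∂μ) * star (∫ ξ, f ξ ∂μ) = ∫ h, ∫ ξ, f (ξ + h) * star (f ξ) ∂μ ∂μ := by
  have hint : Integrable (fun z : G × G => f (z.1 + z.2) * star (f z.1)) (μ.prod μ) := by
    have hconj : Integrable (fun ξ => star (f ξ)) μ :=
      (RCLike.conjCLE (K := ℂ)).integrable_comp_iff.2 hf
    exact ((measurePreserving_prod_add μ μ).integrable_comp_of_integrable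
      (hconj.mul_prod hf)).congr (.of_forall fun z => mul_comm _ _)
  rw [← integral_integral_swap hint]
  simp only [integral_mul_const, integral_add_left_eq_self, integral_const_mul]
  exact congrArg _ integral_conj.symm

variable {V : Type*} [NormedAddCommGroup V] [InnerProductSpace ℝ V] [FiniteDimensional ℝ V]
  [MeasurableSpace V] [BorelSpace V]

/-- The rescaled frequency-localized integral `∫ e^{iλ(‖ξ‖^ϖ + y·ξ)} ‖ξ‖^η ψ(ξ) dξ`, where `ψ` is
the `annulusCutoff`. -/
noncomputable def annulusIntegral (ϖ η lam : ℝ) (y : V) : ℂ :=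
  ∫ ξ, expI (lam * (smoothPow ϖ ξ + inner ℝ y ξ)) * annulusAmp η ξ

/-- The correlation of `e^{iλ‖ξ‖^ϖ} ‖ξ‖^η ψ(ξ)` with its translate by `h`, where `ψ` is the
`annulusCutoff`. -/
noncomputable def annulusCorrelation (ϖ η lam : ℝ) (h : V) : ℂ :=
  ∫ ξ, expI (lam * (smoothPow ϖ (ξ + h) - smoothPow ϖ ξ)) *
    (annulusAmp η (ξ + h) * annulusAmp η ξ : ℝ)

theorem annulusCorrelation_eq_zero {ϖ η lam : ℝ} {h : V} (hh : 4 < ‖h‖) :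
    annulusCorrelation ϖ η lam h = 0 := by
  refine integral_eq_zero_of_ae (.of_forall fun ξ => ?_)
  by_contra hne
  have hamp := Complex.ofReal_ne_zero.1 (right_ne_zero_of_mul hne)
  have hξh := norm_mem_of_annulusAmp_ne_zero (left_ne_zero_of_mul hamp)
  have hξ := norm_mem_of_annulusAmp_ne_zero (right_ne_zero_of_mul hamp)
  have hle : ‖h‖ ≤ ‖ξ + h‖ + ‖ξ‖ := by simpa using norm_sub_le (ξ + h) ξ
  linarith [hξh.2, hξ.2]

theorem exists_annulusCorrelation_bound {ϖ : ℝ} (hϖ : 2 ≤ ϖ) (M : ℝ) (N : ℕ) :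
    ∃ C : ℝ, 0 ≤ C ∧ ∀ η ∈ Set.Icc 0 M, ∀ lam : ℝ, 0 < lam → ∀ h : V, h ≠ 0 →
      ‖annulusCorrelation ϖ η lam h‖ ≤ C * (lam * ‖h‖)⁻¹ ^ N := by
  let Φ (q : (ℝ × ℝ × V) × V) : ℝ := phaseQuotient ϖ q.1.2.1 q.1.2.2 q.2
  let f (q : (ℝ × ℝ × V) × V) : ℝ :=
    annulusAmp q.1.1 (q.2 + q.1.2.1 • q.1.2.2) * annulusAmp q.1.1 q.2
  have hc : 0 < ϖ * (1 / 2 : ℝ) ^ (ϖ - 2) := by positivity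
  have hΦ : ContDiff ℝ ∞ Φ := contDiff_phaseQuotient ϖ (by fun_prop) (by fun_prop) (by fun_prop)
  have hf : ContDiff ℝ ∞ f :=
    (contDiff_annulusAmp (by fun_prop) (by fun_prop)).mul
      (contDiff_annulusAmp (by fun_prop) (by fun_prop))
  have hK : IsCompact (Set.Icc 0 M ×ˢ (Set.Icc (0 : ℝ) 4 ×ˢ Metric.closedBall (0 : V) 1)) :=
    isCompact_Icc.prod (isCompact_Icc.prod (isCompact_closedBall _ _))
  obtain ⟨C, hC, hbound⟩ := exists_nonstationary_phase_bound volume hc 2 hΦ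
    (W := fun q => q.1.2.2) (by fun_prop) hf hK N
  refine ⟨C, hC, fun η hη lam hlam h hh => ?_⟩
  rcases lt_or_ge 4 ‖h‖ with h4 | h4
  · rw [annulusCorrelation_eq_zero h4, norm_zero]
    positivity
  have hr : 0 < ‖h‖ := norm_pos_iff.2 hh
  obtain ⟨e, he, hre⟩ : ∃ e : V, ‖e‖ = 1 ∧ ‖h‖ • e = h :=
    ⟨‖h‖⁻¹ • h, norm_smul_inv_norm hh, smul_inv_smul₀ hr.ne' h⟩
  have hsupp : ∀ ξ ∉ nonstationarySet (ϖ * (1 / 2) ^ (ϖ - 2)) 2 Φ (fun q => q.1.2.2) (η, ‖h‖, e),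
      f ((η, ‖h‖, e), ξ) = 0 := fun ξ hξ => by
    by_contra hne
    have hξr := norm_mem_of_annulusAmp_ne_zero (left_ne_zero_of_mul hne)
    have hξ' := norm_mem_of_annulusAmp_ne_zero (right_ne_zero_of_mul hne)
    refine hξ ⟨hξ'.2.le, ?_⟩
    rw [derivSnd_eq_fderiv hΦ]
    exact le_fderiv_phaseQuotient hϖ hr he (by norm_num) hξ'.1.le hξr.1.le
  have hmain := hbound (η, ‖h‖, e) ⟨hη, ⟨hr.le, h4⟩, by simp [he]⟩ hsupp (lam * ‖h‖) (by positivity)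
  simp only [Φ, f, mul_assoc lam, mul_phaseQuotient, hre] at hmain
  exact hmain

theorem le_mul_inv_one_add_pow {A C₀ C₁ u : ℝ} {n : ℕ} (hA : 0 ≤ A) (hC₁ : 0 ≤ C₁) (hu : 0 < u)
    (h₀ : A ≤ C₀) (h₁ : A ≤ C₁ * u⁻¹ ^ n) :
    A ≤ 2 ^ n * (C₀ + C₁) * ((1 + u) ^ n)⁻¹ := by
  rw [← div_eq_mul_inv, le_div_iff₀ (by positivity)]
  rcases le_total u 1 with hu1 | hu1
  · calc
      A * (1 + u) ^ n ≤ C₀ * 2 ^ n := by gcongr; exacts [hA.trans h₀, by linarith]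
      _ ≤ 2 ^ n * (C₀ + C₁) := by nlinarith [mul_nonneg hC₁ (pow_nonneg zero_le_two n)]
  · calc
      A * (1 + u) ^ n ≤ C₁ * u⁻¹ ^ n * (2 * u) ^ n := by gcongr; linarith
      _ = C₁ * 2 ^ n := by rw [mul_pow, inv_pow]; field_simp
      _ ≤ 2 ^ n * (C₀ + C₁) := by
        nlinarith [mul_nonneg (hA.trans h₀) (pow_nonneg (zero_le_two (α := ℝ)) n)]

theorem integrable_expI_mul_annulusAmp (ϖ η lam : ℝ) (y : V) :
    Integrable fun ξ => expI (lam * (smoothPow ϖ ξ + inner ℝ y ξ)) * annulusAmp η ξ := by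
  have hamp : Continuous fun ξ : V => annulusAmp η ξ :=
    (contDiff_annulusAmp contDiff_const contDiff_id).continuous
  have hpow := (contDiff_smoothPow_const (V := V) ϖ).continuous
  have hexp := contDiff_expI.continuous
  refine Continuous.integrable_of_hasCompactSupport (by fun_prop)
    (.intro (isCompact_closedBall 0 2) fun ξ hξ => ?_)
  rw [mem_closedBall_zero_iff, not_le] at hξ
  rw [annulusAmp, annulusCutoff_of_ge hξ.le, zero_mul, Complex.ofReal_zero, mul_zero]

theorem norm_annulusIntegral_sq (ϖ η lam : ℝ) (y : V) :
    ‖annulusIntegral ϖ η lam y‖ ^ 2 =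
      ‖∫ h : V, expI (lam * inner ℝ y h) * annulusCorrelation ϖ η lam h‖ := by
  have hnorm : ‖annulusIntegral ϖ η lam y‖ ^ 2 =
      ‖annulusIntegral ϖ η lam y * star (annulusIntegral ϖ η lam y)‖ := by
    rw [norm_mul, norm_star, sq]
  rw [hnorm, annulusIntegral, integral_mul_star_integral volume
    (integrable_expI_mul_annulusAmp ϖ η lam y)]
  simp only [annulusCorrelation, ← integral_const_mul]
  refine congrArg norm (integral_congr_ae (.of_forall fun h => integral_congr_ae
    (.of_forall fun ξ => ?_)))
  beta_reduce
  have hphase : expI (lam * (smoothPow ϖ (ξ + h) + inner ℝ y (ξ + h))) *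
      expI (-(lam * (smoothPow ϖ ξ + inner ℝ y ξ))) =
      expI (lam * inner ℝ y h) * expI (lam * (smoothPow ϖ (ξ + h) - smoothPow ϖ ξ)) := by
    rw [← expI_add, ← expI_add, inner_add_right]
    congr 1
    ring
  rw [star_mul', star_expI, Complex.star_def, Complex.conj_ofReal, Complex.ofReal_mul]
  linear_combination (annulusAmp η (ξ + h) * annulusAmp η ξ : ℂ) * hphase

theorem exists_annulusIntegral_sq_bound [Nontrivial V] {ϖ : ℝ} (hϖ : 2 ≤ ϖ) (M : ℝ) :
    ∃ C : ℝ, 0 ≤ C ∧ ∀ η ∈ Set.Icc 0 M, ∀ lam : ℝ, 0 < lam → ∀ y : V,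
      ‖annulusIntegral ϖ η lam y‖ ^ 2 ≤ C * lam⁻¹ ^ Module.finrank ℝ V := by
  set n := Module.finrank ℝ V
  obtain ⟨C₀, hC₀, hbound₀⟩ := exists_annulusCorrelation_bound (V := V) hϖ M 0
  obtain ⟨C₁, hC₁, hbound₁⟩ := exists_annulusCorrelation_bound (V := V) hϖ M (n + 1)
  let g (h : V) : ℝ := ((1 + ‖h‖) ^ (n + 1))⁻¹
  have hg : Integrable g := by
    refine (integrable_one_add_norm (E := V) (r := n + 1) (by simp [n])).congr
      (.of_forall fun h => ?_)
    simp only [g]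
    rw [Real.rpow_neg (by positivity)]
    norm_cast
  let B := 2 ^ (n + 1) * (C₀ + C₁)
  refine ⟨B * ∫ h, g h, mul_nonneg (by positivity) (integral_nonneg fun h => by positivity),
    fun η hη lam hlam y => ?_⟩
  have hdecay : ∀ h : V, h ≠ 0 → ‖annulusCorrelation ϖ η lam h‖ ≤ B * g (lam • h) :=
    fun h hh => by
      have hu : 0 < lam * ‖h‖ := mul_pos hlam (norm_pos_iff.2 hh)
      simp only [g, norm_smul, Real.norm_of_nonneg hlam.le]
      exact le_mul_inv_one_add_pow (norm_nonneg _) hC₁ hu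
        (by simpa using hbound₀ η hη lam hlam h hh) (hbound₁ η hη lam hlam h hh)
  have hscale : ∫ h : V, B * g (lam • h) = B * (∫ h, g h) * lam⁻¹ ^ n := by
    rw [integral_const_mul, Measure.integral_comp_smul_of_nonneg volume g lam (hR := hlam.le),
      smul_eq_mul, inv_pow]
    ring
  rw [norm_annulusIntegral_sq, ← hscale]
  refine norm_integral_le_of_norm_le ((hg.comp_smul hlam.ne').const_mul B) ?_
  filter_upwards [compl_mem_ae_iff.2 (measure_singleton (0 : V))] with h hh
  rw [norm_mul, norm_expI, one_mul]
  exact hdecay h hh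

end StationaryPhase

section Noncritical

variable {V : Type*} [NormedAddCommGroup V] [InnerProductSpace ℝ V]

/-- A size `r` of the linear term `y` for which `‖ξ‖ ^ ϖ + y · ξ` has no critical point in the
annulus `1/2 < ‖ξ‖ < 2`, by a fixed margin. -/
def Noncritical (ϖ r : ℝ) : Prop := r ≤ ϖ * (1 / 2) ^ ϖ ∨ ϖ * 2 ^ ϖ ≤ r

/-- The phase `s ‖ξ‖ ^ ϖ + y · ξ`; the weight `s` lets it degenerate to a linear phase, which keeps
the parameters `(s, y)` in a compact set. -/
noncomputable def pencilPhase (ϖ s : ℝ) (y ξ : V) : ℝ := s * smoothPow ϖ ξ + inner ℝ y ξ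

theorem fderiv_pencilPhase {ϖ : ℝ} (hϖ : 1 < ϖ) (s : ℝ) (y : V) {ξ : V} (hξ : 1 / 4 < ‖ξ‖)
    (v : V) :
    fderiv ℝ (pencilPhase ϖ s y) ξ v = s * (ϖ * ‖ξ‖ ^ (ϖ - 2) * inner ℝ ξ v) + inner ℝ y v := by
  have hderiv : HasFDerivAt (pencilPhase ϖ s y) (s • fderiv ℝ (smoothPow ϖ) ξ + innerSL ℝ y) ξ :=
    ((differentiable_smoothPow_const ϖ ξ).hasFDerivAt.const_mul s).add (innerSL ℝ y).hasFDerivAt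
  rw [hderiv.fderiv]
  simp [fderiv_smoothPow hϖ hξ]

theorem rpow_sub_two_mul_self {r : ℝ} (hr : 0 < r) (ϖ : ℝ) : r ^ (ϖ - 2) * r = r ^ (ϖ - 1) := by
  rw [← Real.rpow_add_one hr.ne']
  ring_nf

theorem le_fderiv_pencilPhase_self {ϖ : ℝ} (hϖ : 2 ≤ ϖ) {y ξ : V} (hy : ‖y‖ ≤ ϖ * (1 / 2) ^ ϖ)
    (hξ : 1 / 2 < ‖ξ‖) : ϖ * (1 / 2) ^ ϖ * (1 / 2) ≤ fderiv ℝ (pencilPhase ϖ 1 y) ξ ξ := by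
  have hξ₀ : 0 < ‖ξ‖ := by linarith
  have hradial : 2 * (ϖ * (1 / 2) ^ ϖ) * ‖ξ‖ ≤ ϖ * ‖ξ‖ ^ (ϖ - 2) * ‖ξ‖ ^ 2 := calc
    2 * (ϖ * (1 / 2) ^ ϖ) * ‖ξ‖ = ϖ * (1 / 2) ^ (ϖ - 1) * ‖ξ‖ := by
      rw [Real.rpow_sub_one (by norm_num)]; ring
    _ ≤ ϖ * ‖ξ‖ ^ (ϖ - 1) * ‖ξ‖ := by gcongr; linarith
    _ = ϖ * ‖ξ‖ ^ (ϖ - 2) * ‖ξ‖ ^ 2 := by rw [← rpow_sub_two_mul_self hξ₀]; ring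
  have hlinear : -(‖y‖ * ‖ξ‖) ≤ inner ℝ y ξ := (abs_le.1 (abs_real_inner_le_norm y ξ)).1
  have hmargin : 0 < ϖ * (1 / 2 : ℝ) ^ ϖ := by positivity
  rw [fderiv_pencilPhase (by linarith) 1 y (by linarith), real_inner_self_eq_norm_sq, one_mul]
  linarith [mul_le_mul_of_nonneg_right hy hξ₀.le, mul_le_mul_of_nonneg_left hξ.le hmargin.le]

theorem le_fderiv_pencilPhase_unit {ϖ s : ℝ} (hϖ : 2 ≤ ϖ) (hs : 0 ≤ s) (hs' : s * (ϖ * 2 ^ ϖ) ≤ 1)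
    {e ξ : V} (he : ‖e‖ = 1) (hξ : 1 / 2 < ‖ξ‖) (hξ' : ‖ξ‖ ≤ 2) :
    1 / 2 ≤ fderiv ℝ (pencilPhase ϖ s e) ξ e := by
  have hξ₀ : 0 < ‖ξ‖ := by linarith
  have hinner : -‖ξ‖ ≤ inner ℝ ξ e := by
    simpa [he] using (abs_le.1 (abs_real_inner_le_norm ξ e)).1
  have hradial : s * (ϖ * ‖ξ‖ ^ (ϖ - 2) * ‖ξ‖) ≤ 1 / 2 := calc
    s * (ϖ * ‖ξ‖ ^ (ϖ - 2) * ‖ξ‖) = s * (ϖ * ‖ξ‖ ^ (ϖ - 1)) := by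
      rw [mul_assoc ϖ, rpow_sub_two_mul_self hξ₀]
    _ ≤ s * (ϖ * 2 ^ (ϖ - 1)) := by gcongr; linarith
    _ = s * (ϖ * 2 ^ ϖ) * (1 / 2) := by rw [Real.rpow_sub_one (by norm_num)]; ring
    _ ≤ 1 / 2 := by linarith
  rw [fderiv_pencilPhase (by linarith) s e (by linarith), real_inner_self_eq_norm_sq, he]
  nlinarith [mul_le_mul_of_nonneg_left hinner
    (show 0 ≤ s * (ϖ * ‖ξ‖ ^ (ϖ - 2)) by positivity)]

variable [FiniteDimensional ℝ V] [MeasurableSpace V] [BorelSpace V]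

theorem exists_pencilPhase_integral_bound (ϖ : ℝ) {c : ℝ} (hc : 0 < c) {W : V → V → V}
    (hW : ContDiff ℝ ∞ fun q : V × V => W q.1 q.2) (M A : ℝ) (N : ℕ) :
    ∃ C : ℝ, 0 ≤ C ∧ ∀ η ∈ Set.Icc 0 M, ∀ s ∈ Set.Icc (0 : ℝ) 1, ∀ y : V, ‖y‖ ≤ A →
      (∀ ξ, 1 / 2 < ‖ξ‖ → ‖ξ‖ ≤ 2 → c ≤ fderiv ℝ (pencilPhase ϖ s y) ξ (W y ξ)) →
      ∀ lam : ℝ, 0 < lam →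
      ‖∫ ξ, expI (lam * pencilPhase ϖ s y ξ) * annulusAmp η ξ‖ ≤ C * lam⁻¹ ^ N := by
  let Φ (q : (ℝ × ℝ × V) × V) : ℝ := pencilPhase ϖ q.1.2.1 q.1.2.2 q.2
  have hΦ : ContDiff ℝ ∞ Φ :=
    (ContDiff.mul (by fun_prop) ((contDiff_smoothPow_const ϖ).comp contDiff_snd)).add
      (.inner ℝ (by fun_prop) (by fun_prop))
  have hf : ContDiff ℝ ∞ fun q : (ℝ × ℝ × V) × V => annulusAmp q.1.1 q.2 :=
    contDiff_annulusAmp (by fun_prop) (by fun_prop)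
  have hK : IsCompact (Set.Icc 0 M ×ˢ (Set.Icc (0 : ℝ) 1 ×ˢ Metric.closedBall (0 : V) A)) :=
    isCompact_Icc.prod (isCompact_Icc.prod (isCompact_closedBall _ _))
  have hW' : ContDiff ℝ ∞ fun q : (ℝ × ℝ × V) × V => W q.1.2.2 q.2 :=
    hW.comp (g := fun q : V × V => W q.1 q.2) (f := fun q : (ℝ × ℝ × V) × V => (q.1.2.2, q.2))
      (by fun_prop)
  obtain ⟨C, hC, hbound⟩ := exists_nonstationary_phase_bound volume hc 2 hΦ hW' hf hK N
  refine ⟨C, hC, fun η hη s hs y hy hlower lam hlam =>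
    hbound (η, s, y) ⟨hη, hs, by simpa using hy⟩ (fun ξ hξ => ?_) lam hlam⟩
  by_contra hne
  obtain ⟨hξ₁, hξ₂⟩ := norm_mem_of_annulusAmp_ne_zero hne
  refine hξ ⟨hξ₂.le, ?_⟩
  rw [derivSnd_eq_fderiv hΦ]
  exact hlower ξ hξ₁ hξ₂.le

theorem exists_annulusIntegral_noncritical_bound {ϖ : ℝ} (hϖ : 2 ≤ ϖ) (M : ℝ) (N : ℕ) :
    ∃ C : ℝ, 0 ≤ C ∧ ∀ η ∈ Set.Icc 0 M, ∀ lam : ℝ, 0 < lam → ∀ y : V, Noncritical ϖ ‖y‖ →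
      ‖annulusIntegral ϖ η lam y‖ ≤ C * lam⁻¹ ^ N := by
  obtain ⟨C₁, hC₁, hsmall⟩ := exists_pencilPhase_integral_bound (V := V) ϖ
    (c := ϖ * (1 / 2) ^ ϖ * (1 / 2)) (by positivity) (W := fun _ ξ => ξ) contDiff_snd M
    (ϖ * (1 / 2) ^ ϖ) N
  obtain ⟨C₂, hC₂, hlarge⟩ := exists_pencilPhase_integral_bound (V := V) ϖ
    (c := 1 / 2) (by positivity) (W := fun y _ => y) contDiff_fst M 1 N
  refine ⟨C₁ + C₂, by positivity, fun η hη lam hlam y hy => ?_⟩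
  rcases hy with hy | hy
  · have hbound := hsmall η hη 1 ⟨zero_le_one, le_rfl⟩ y hy
      (fun ξ hξ _ => le_fderiv_pencilPhase_self hϖ hy hξ) lam hlam
    simp only [pencilPhase, one_mul] at hbound
    exact hbound.trans (by gcongr; linarith)
  · have hone : 1 ≤ ϖ * 2 ^ ϖ := by
      nlinarith [Real.one_le_rpow (one_le_two (α := ℝ)) (by linarith : 0 ≤ ϖ)]
    have hy₁ : 1 ≤ ‖y‖ := hone.trans hy
    have hy₀ : 0 < ‖y‖ := by linarith
    have he : ‖‖y‖⁻¹ • y‖ = 1 := norm_smul_inv_norm (𝕜 := ℝ) (norm_pos_iff.1 hy₀)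
    have hbound := hlarge η hη ‖y‖⁻¹ ⟨by positivity, inv_le_one_of_one_le₀ hy₁⟩ (‖y‖⁻¹ • y) he.le
      (fun ξ hξ hξ' => le_fderiv_pencilPhase_unit hϖ (by positivity)
        ((inv_mul_le_one₀ hy₀).2 hy) he hξ hξ') (lam * ‖y‖) (by positivity)
    have hphase (ξ : V) :
        ‖y‖ * pencilPhase ϖ ‖y‖⁻¹ (‖y‖⁻¹ • y) ξ = smoothPow ϖ ξ + inner ℝ y ξ := by
      rw [pencilPhase, real_inner_smul_left]
      field_simp
    simp only [mul_assoc lam, hphase] at hbound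
    refine hbound.trans ?_
    gcongr
    · linarith
    · exact le_mul_of_one_le_right hlam.le hy₁

end Noncritical

/-! ### Inverse Fourier transforms and oscillatory integrals -/

section InverseFourier

variable {d : ℕ} {m K g φ : EuclideanSpace ℝ (Fin d) → ℂ}

theorem integrable_expI_mul {X : Type*} [TopologicalSpace X] [MeasurableSpace X]
    [OpensMeasurableSpace X] {μ : Measure X} {u : X → ℝ} {f : X → ℂ} (hu : Continuous u)
    (hf : Integrable f μ) : Integrable (fun x => expI (u x) * f x) μ :=
  hf.bdd_mul (c := 1) (contDiff_expI.continuous.comp hu).aestronglyMeasurable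
    (.of_forall fun _ => (norm_expI _).le)

theorem invFourier_apply (φ : EuclideanSpace ℝ (Fin d) → ℂ) (ξ : EuclideanSpace ℝ (Fin d)) :
    invFourier φ ξ = ∫ x, expI (inner ℝ x ξ) * φ x := rfl

theorem invFourier_eq_vectorFourier (φ : EuclideanSpace ℝ (Fin d) → ℂ) :
    invFourier φ = VectorFourier.fourierIntegral Real.probChar volume
      (-innerₗ (EuclideanSpace ℝ (Fin d))) φ := by
  ext ξ
  simp [VectorFourier.fourierIntegral_probChar, invFourier, mul_comm Complex.I]

theorem continuous_neg_innerₗ :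
    Continuous fun p : EuclideanSpace ℝ (Fin d) × EuclideanSpace ℝ (Fin d) =>
      (-innerₗ (EuclideanSpace ℝ (Fin d))) p.1 p.2 :=
  continuous_inner.neg

theorem continuous_invFourier (hg : Integrable g) : Continuous (invFourier g) := by
  rw [invFourier_eq_vectorFourier]
  exact VectorFourier.fourierIntegral_continuous Real.continuous_probChar continuous_neg_innerₗ hg

theorem integral_mul_invFourier (hg : Integrable g) (hφ : Integrable φ) :
    ∫ ξ, g ξ * invFourier φ ξ = ∫ x, invFourier g x * φ x := by
  have h := VectorFourier.integral_fourierIntegral_smul_eq_flip Real.continuous_probChar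
    continuous_neg_innerₗ hg hφ
  have hflip : (-innerₗ (EuclideanSpace ℝ (Fin d))).flip = -innerₗ (EuclideanSpace ℝ (Fin d)) := by
    ext
    simp [real_inner_comm]
  rw [hflip] at h
  simpa only [← invFourier_eq_vectorFourier, smul_eq_mul] using h.symm

theorem invFourier_sub {f : EuclideanSpace ℝ (Fin d) → ℂ} (hf : Integrable f) (hg : Integrable g)
    (x : EuclideanSpace ℝ (Fin d)) :
    invFourier (f - g) x = invFourier f x - invFourier g x := by
  simp only [invFourier_apply, Pi.sub_apply, mul_sub]
  exact integral_sub (integrable_expI_mul (by fun_prop) hf) (integrable_expI_mul (by fun_prop) hg)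

theorem invFourier_comp_inv_smul (φ : EuclideanSpace ℝ (Fin d) → ℂ) {s : ℝ} (hs : 0 < s)
    (ξ : EuclideanSpace ℝ (Fin d)) :
    invFourier (fun x => φ (s⁻¹ • x)) ξ = (s ^ d : ℝ) * invFourier φ (s • ξ) := by
  have h := Measure.integral_comp_inv_smul_of_nonneg volume
    (fun x => expI (inner ℝ x (s • ξ)) * φ x) hs.le
  simp only [real_inner_smul_left, real_inner_smul_right, mul_inv_cancel_left₀ hs.ne',
    finrank_euclideanSpace_fin, Complex.real_smul] at h
  simpa only [invFourier_apply, real_inner_smul_right] using h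

theorem invFourier_comp_sub (φ : EuclideanSpace ℝ (Fin d) → ℂ) (x ξ : EuclideanSpace ℝ (Fin d)) :
    invFourier (fun y => φ (y - x)) ξ = expI (inner ℝ x ξ) * invFourier φ ξ := by
  have h := integral_sub_right_eq_self (μ := volume)
    (fun y => expI (inner ℝ (y + x) ξ) * φ y) x
  simp only [sub_add_cancel, inner_add_left _ x, add_comm _ (inner ℝ x ξ), expI_add, mul_assoc,
    integral_const_mul] at h
  exact h

theorem exists_schwartzMap_comp_smul (χ : 𝓢(EuclideanSpace ℝ (Fin d), ℂ)) {s : ℝ} (hs : s ≠ 0) :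
    ∃ ψ : 𝓢(EuclideanSpace ℝ (Fin d), ℂ), ∀ ξ, ψ ξ = χ (s • ξ) :=
  ⟨SchwartzMap.compCLMOfContinuousLinearEquiv ℂ
    (ContinuousLinearEquiv.smulLeft (Units.mk0 s hs)) χ, fun _ => rfl⟩

theorem invFourier_eq_fourierInv (φ : EuclideanSpace ℝ (Fin d) → ℂ)
    (ξ : EuclideanSpace ℝ (Fin d)) :
    invFourier φ ξ = FourierTransformInv.fourierInv φ ((2 * Real.pi)⁻¹ • ξ) := by
  simp only [invFourier, Real.fourierInv_eq', smul_eq_mul, real_inner_smul_right,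
    mul_inv_cancel_left₀ Real.two_pi_pos.ne', mul_comm Complex.I]

theorem exists_schwartzMap_eq_invFourier (φ : 𝓢(EuclideanSpace ℝ (Fin d), ℂ)) :
    ∃ χ : 𝓢(EuclideanSpace ℝ (Fin d), ℂ), ∀ ξ, χ ξ = invFourier φ ξ := by
  obtain ⟨χ, hχ⟩ := exists_schwartzMap_comp_smul (FourierTransformInv.fourierInv φ)
    (inv_ne_zero Real.two_pi_pos.ne')
  exact ⟨χ, fun ξ => by rw [hχ, invFourier_eq_fourierInv, SchwartzMap.fourierInv_coe]⟩

theorem exists_schwartzMap_invFourier_eq (χ : 𝓢(EuclideanSpace ℝ (Fin d), ℂ)) :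
    ∃ φ : 𝓢(EuclideanSpace ℝ (Fin d), ℂ), ∀ ξ, invFourier φ ξ = χ ξ := by
  obtain ⟨ψ, hψ⟩ := exists_schwartzMap_comp_smul χ Real.two_pi_pos.ne'
  refine ⟨FourierTransform.fourier ψ, fun ξ => ?_⟩
  rw [invFourier_eq_fourierInv, ← SchwartzMap.fourierInv_coe,
    FourierTransform.fourierInv_fourier_eq, hψ,
    smul_inv_smul₀ (ne_of_gt Real.two_pi_pos)]

/-- `K` is the inverse Fourier transform of `m`, tested against all integrable `φ` for which
`m · 𝓕⁻¹φ` is integrable. Compared with `IsInvFourierTransform`, the larger class of test functions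
makes the notion stable under pointwise limits without regard to smoothness. -/
def IsWeakInvFourier (m K : EuclideanSpace ℝ (Fin d) → ℂ) : Prop :=
  ∀ φ : EuclideanSpace ℝ (Fin d) → ℂ, Integrable φ → Integrable (fun ξ => m ξ * invFourier φ ξ) →
    ∫ ξ, m ξ * invFourier φ ξ = ∫ x, K x * φ x

theorem IsWeakInvFourier.const_mul (h : IsWeakInvFourier m K) {c : ℂ} (hc : c ≠ 0) :
    IsWeakInvFourier (fun ξ => c * m ξ) (fun x => c * K x) := by
  intro φ hφ hm
  simp only [mul_assoc] at hm ⊢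
  rw [integral_const_mul, integral_const_mul, h φ hφ ((integrable_const_mul_iff hc.isUnit _).1 hm)]

theorem IsWeakInvFourier.modulate (h : IsWeakInvFourier m K) (x : EuclideanSpace ℝ (Fin d)) :
    IsWeakInvFourier (fun ξ => expI (inner ℝ x ξ) * m ξ) (fun y => K (x + y)) := by
  intro φ hφ hm
  have hmod (ξ : EuclideanSpace ℝ (Fin d)) : expI (inner ℝ x ξ) * m ξ * invFourier φ ξ =
      m ξ * invFourier (fun y => φ (y - x)) ξ := by
    rw [invFourier_comp_sub]
    ring
  simp only [hmod] at hm ⊢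
  rw [h _ (hφ.comp_sub_right x) hm]
  simpa only [add_sub_cancel] using
    integral_sub_right_eq_self (μ := volume) (fun y => K (x + y) * φ y) x

theorem IsWeakInvFourier.integral_mul_invFourier_smul (h : IsWeakInvFourier m K) {s : ℝ}
    (hs : 0 < s) (hφ : Integrable φ) (hm : Integrable fun ξ => m ξ * invFourier φ (s • ξ)) :
    ∫ ξ, m ξ * invFourier φ (s • ξ) = ∫ x, K (s • x) * φ x := by
  have hsd : ((s ^ d : ℝ) : ℂ) ≠ 0 := Complex.ofReal_ne_zero.2 (by positivity)
  have hpair := h (fun x => φ (s⁻¹ • x)) (hφ.comp_smul (inv_ne_zero hs.ne'))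
  simp only [invFourier_comp_inv_smul φ hs, mul_left_comm (m _), integral_const_mul] at hpair
  have hdilate := Measure.integral_comp_inv_smul_of_nonneg volume
    (fun x => K (s • x) * φ x) hs.le
  simp only [smul_inv_smul₀ hs.ne', finrank_euclideanSpace_fin, Complex.real_smul] at hdilate
  exact mul_left_cancel₀ hsd ((hpair (hm.const_mul _)).trans hdilate)

theorem IsWeakInvFourier.comp_inv_smul (h : IsWeakInvFourier m K) {s : ℝ} (hs : 0 < s) :
    IsWeakInvFourier (fun ξ => m (s⁻¹ • ξ)) (fun x => (s ^ d : ℝ) * K (s • x)) := by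
  intro φ hφ hm
  have hm' := hm.comp_smul hs.ne'
  have hdilate := Measure.integral_comp_inv_smul_of_nonneg volume
    (fun ξ => m ξ * invFourier φ (s • ξ)) hs.le
  simp only [inv_smul_smul₀ hs.ne'] at hm'
  simp only [smul_inv_smul₀ hs.ne', finrank_euclideanSpace_fin, Complex.real_smul] at hdilate
  simp only [mul_assoc, integral_const_mul]
  rw [hdilate, h.integral_mul_invFourier_smul hs hφ hm']

theorem IsWeakInvFourier.of_tendsto {m' : ℕ → EuclideanSpace ℝ (Fin d) → ℂ} {C : ℝ}
    (hm' : ∀ n, Integrable (m' n)) (hle : ∀ n ξ, ‖m' n ξ‖ ≤ ‖m ξ‖)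
    (hm : ∀ ξ, Tendsto (fun n => m' n ξ) atTop (𝓝 (m ξ)))
    (hC : ∀ n x, ‖invFourier (m' n) x‖ ≤ C)
    (hK : ∀ x, Tendsto (fun n => invFourier (m' n) x) atTop (𝓝 (K x))) :
    IsWeakInvFourier m K := by
  intro φ hφ hint
  have hleft : Tendsto (fun n => ∫ ξ, m' n ξ * invFourier φ ξ) atTop
      (𝓝 (∫ ξ, m ξ * invFourier φ ξ)) := by
    refine tendsto_integral_of_dominated_convergence _ (fun n => ?_) hint.norm
      (fun n => .of_forall fun ξ => ?_) (.of_forall fun ξ => (hm ξ).mul_const _)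
    · exact (hm' n).aestronglyMeasurable.mul (continuous_invFourier hφ).aestronglyMeasurable
    · rw [norm_mul, norm_mul]
      exact mul_le_mul_of_nonneg_right (hle n ξ) (norm_nonneg _)
  have hright : Tendsto (fun n => ∫ x, invFourier (m' n) x * φ x) atTop (𝓝 (∫ x, K x * φ x)) := by
    refine tendsto_integral_of_dominated_convergence (fun x => C * ‖φ x‖) (fun n => ?_)
      (hφ.norm.const_mul C) (fun n => .of_forall fun x => ?_)
      (.of_forall fun x => (hK x).mul_const _)
    · exact (continuous_invFourier (hm' n)).aestronglyMeasurable.mul hφ.aestronglyMeasurable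
    · rw [norm_mul]
      exact mul_le_mul_of_nonneg_right (hC n x) (norm_nonneg _)
  simp only [← integral_mul_invFourier (hm' _) hφ] at hright
  exact tendsto_nhds_unique hleft hright

theorem tendsto_integral_comp_smul_mul {C : ℝ} (hK : Continuous K) (hC : ∀ x, ‖K x‖ ≤ C)
    (hφ : Integrable φ) :
    Tendsto (fun ε : ℝ => ∫ x, K (ε • x) * φ x) (𝓝 0) (𝓝 (K 0 * ∫ x, φ x)) := by
  rw [← integral_const_mul]
  refine tendsto_integral_filter_of_dominated_convergence (fun x => C * ‖φ x‖)
    (.of_forall fun ε => ?_) (.of_forall fun ε => .of_forall fun x => ?_)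
    (hφ.norm.const_mul C) (.of_forall fun x => ?_)
  · exact (hK.comp (continuous_const_smul ε)).aestronglyMeasurable.mul hφ.aestronglyMeasurable
  · rw [norm_mul]
    exact mul_le_mul_of_nonneg_right (hC _) (norm_nonneg _)
  · have hcont : Continuous fun ε : ℝ => K (ε • x) * φ x := by fun_prop
    simpa using hcont.tendsto 0

theorem IsWeakInvFourier.hasOscillatoryIntegral (h : IsWeakInvFourier m K)
    (hm : ∀ χ : 𝓢(EuclideanSpace ℝ (Fin d), ℂ), Integrable fun ξ => m ξ * χ ξ) {C : ℝ}
    (hK : Continuous K) (hC : ∀ x, ‖K x‖ ≤ C) : HasOscillatoryIntegral m (K 0) := by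
  intro χ hχ
  obtain ⟨φ, hφ⟩ := exists_schwartzMap_invFourier_eq χ
  have hint (ε : ℝ) (hε : 0 < ε) : Integrable fun ξ => m ξ * χ (ε • ξ) := by
    obtain ⟨ψ, hψ⟩ := exists_schwartzMap_comp_smul χ hε.ne'
    simpa only [hψ] using hm ψ
  have hmass : ∫ x, φ x = 1 := by
    rw [← hχ, ← hφ, invFourier]
    simp
  refine ⟨hint, ?_⟩
  have hlim := (tendsto_integral_comp_smul_mul hK hC φ.integrable).mono_left
    (nhdsWithin_le_nhds (s := Set.Ioi 0))
  rw [hmass, mul_one] at hlim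
  refine hlim.congr' ?_
  filter_upwards [self_mem_nhdsWithin] with ε hε
  have hpair := h.integral_mul_invFourier_smul hε φ.integrable
  simp only [hφ] at hpair
  exact (hpair (hint ε hε)).symm

theorem IsWeakInvFourier.isInvFourierTransform (h : IsWeakInvFourier m K)
    (hm : ∀ χ : 𝓢(EuclideanSpace ℝ (Fin d), ℂ), Integrable fun ξ => m ξ * χ ξ) {C : ℝ}
    (hK : Continuous K) (hC : ∀ x, ‖K x‖ ≤ C) : IsInvFourierTransform m K := by
  intro φ
  obtain ⟨χ, hχ⟩ := exists_schwartzMap_eq_invFourier φ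
  have hint : Integrable fun ξ => m ξ * invFourier φ ξ := by simpa only [hχ] using hm χ
  exact ⟨hint, φ.integrable.bdd_mul hK.aestronglyMeasurable (.of_forall hC), h φ φ.integrable hint⟩

end InverseFourier

/-! ### The dispersive kernel -/

section DyadicPieces

variable {d : ℕ} {ϖ η : ℝ}

/-- The symbol `e^{it‖ξ‖^ϖ} ‖ξ‖^η`. -/
noncomputable def dispSymbol (ϖ η t : ℝ) (ξ : EuclideanSpace ℝ (Fin d)) : ℂ :=
  expI (t * ‖ξ‖ ^ ϖ) * (‖ξ‖ ^ η : ℝ)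

theorem norm_dispSymbol (ϖ η t : ℝ) (ξ : EuclideanSpace ℝ (Fin d)) :
    ‖dispSymbol ϖ η t ξ‖ = ‖ξ‖ ^ η := by
  rw [dispSymbol, norm_mul, norm_expI, one_mul, Complex.norm_real,
    Real.norm_of_nonneg (by positivity)]

theorem continuous_dispSymbol (hϖ : 0 ≤ ϖ) (hη : 0 ≤ η) (t : ℝ) :
    Continuous (dispSymbol ϖ η t : EuclideanSpace ℝ (Fin d) → ℂ) := by
  have hpow {r : ℝ} (hr : 0 ≤ r) : Continuous fun ξ : EuclideanSpace ℝ (Fin d) => ‖ξ‖ ^ r :=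
    continuous_norm.rpow_const fun _ => .inr hr
  exact (contDiff_expI.continuous.comp (continuous_const.mul (hpow hϖ))).mul
    (Complex.continuous_ofReal.comp (hpow hη))

theorem dispSymbol_smul {s : ℝ} (hs : 0 ≤ s) (t : ℝ) (ξ : EuclideanSpace ℝ (Fin d)) :
    dispSymbol ϖ η t (s • ξ) = (s ^ η : ℝ) * dispSymbol ϖ η (t * s ^ ϖ) ξ := by
  rw [dispSymbol, dispSymbol, norm_smul, Real.norm_of_nonneg hs,
    Real.mul_rpow hs (norm_nonneg _), Real.mul_rpow hs (norm_nonneg _), mul_assoc t]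
  push_cast
  ring

theorem dispSymbol_mul_annulusCutoff (ϖ η t : ℝ) (ξ : EuclideanSpace ℝ (Fin d)) :
    dispSymbol ϖ η t ξ * (annulusCutoff ξ : ℝ) = expI (t * smoothPow ϖ ξ) * annulusAmp η ξ := by
  rcases le_or_gt ‖ξ‖ (1 / 2) with hξ | hξ
  · simp [annulusAmp, annulusCutoff_of_le hξ]
  · rw [dispSymbol, annulusAmp, smoothPow_of_le ϖ (by linarith), smoothPow_of_le η (by linarith)]
    push_cast
    ring

/-- The contribution of the frequencies `R/2 < ‖ξ‖ < 2 * R` to the kernel at time `1`. -/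
noncomputable def dyadicKernel (ϖ η R : ℝ) (x : EuclideanSpace ℝ (Fin d)) : ℂ :=
  invFourier (fun ξ => dispSymbol ϖ η 1 ξ * (annulusCutoff (R⁻¹ • ξ) : ℝ)) x

theorem dyadicKernel_eq {R : ℝ} (hR : 0 < R) (x : EuclideanSpace ℝ (Fin d)) :
    dyadicKernel ϖ η R x =
      (R ^ d * R ^ η : ℝ) * annulusIntegral ϖ η (R ^ ϖ) (R ^ (1 - ϖ) • x) := by
  have hsymbol (ξ : EuclideanSpace ℝ (Fin d)) : dispSymbol ϖ η 1 ξ =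
      (R ^ η : ℝ) * dispSymbol ϖ η (R ^ ϖ) (R⁻¹ • ξ) := by
    rw [← one_mul (R ^ ϖ), ← dispSymbol_smul hR.le, smul_inv_smul₀ hR.ne']
  have hphase (ξ : EuclideanSpace ℝ (Fin d)) : expI (inner ℝ ξ (R • x)) *
      expI (R ^ ϖ * smoothPow ϖ ξ) =
      expI (R ^ ϖ * (smoothPow ϖ ξ + inner ℝ (R ^ (1 - ϖ) • x) ξ)) := by
    rw [← expI_add, mul_add, add_comm, real_inner_smul_left, real_inner_smul_right, ← mul_assoc,
      ← Real.rpow_add hR, add_sub_cancel, Real.rpow_one, real_inner_comm]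
  have hpoint (ξ : EuclideanSpace ℝ (Fin d)) : expI (inner ℝ ξ (R • x)) *
      ((R ^ η : ℝ) * (expI (R ^ ϖ * smoothPow ϖ ξ) * annulusAmp η ξ)) =
      (R ^ η : ℝ) * (expI (R ^ ϖ * (smoothPow ϖ ξ + inner ℝ (R ^ (1 - ϖ) • x) ξ)) *
        annulusAmp η ξ) := by
    rw [← hphase]
    ring
  simp only [dyadicKernel, hsymbol]
  rw [invFourier_comp_inv_smul
    (fun ξ => (R ^ η : ℝ) * dispSymbol ϖ η (R ^ ϖ) ξ * (annulusCutoff ξ : ℝ)) hR]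
  simp only [invFourier_apply, mul_assoc, dispSymbol_mul_annulusCutoff, hpoint,
    integral_const_mul]
  rw [← annulusIntegral, Complex.ofReal_mul, mul_assoc]

theorem exists_dyadicKernel_bound [NeZero d] (hϖ : 2 ≤ ϖ) :
    ∃ C : ℝ, 0 ≤ C ∧ ∀ η ∈ Set.Icc 0 (d * (ϖ / 2 - 1)), ∀ R : ℝ, 1 ≤ R →
      ∀ x : EuclideanSpace ℝ (Fin d), ‖dyadicKernel ϖ η R x‖ ≤ C := by
  obtain ⟨C, hC, hbound⟩ := exists_annulusIntegral_sq_bound (V := EuclideanSpace ℝ (Fin d)) hϖ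
    (d * (ϖ / 2 - 1))
  refine ⟨√C, by positivity, fun η hη R hR x => Real.le_sqrt_of_sq_le ?_⟩
  have hR₀ : 0 < R := by linarith
  have hexponent : 2 * (d + η) - ϖ * d ≤ 0 := by linarith [hη.2]
  rw [dyadicKernel_eq hR₀, norm_mul, Complex.norm_real, Real.norm_of_nonneg (by positivity),
    mul_pow]
  calc (R ^ d * R ^ η) ^ 2 * ‖annulusIntegral ϖ η (R ^ ϖ) (R ^ (1 - ϖ) • x)‖ ^ 2
      ≤ (R ^ d * R ^ η) ^ 2 * (C * (R ^ ϖ)⁻¹ ^ d) := by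
        gcongr
        simpa using hbound η hη (R ^ ϖ) (by positivity) (R ^ (1 - ϖ) • x)
    _ = C * R ^ (2 * (d + η) - ϖ * d) := by
        rw [Real.rpow_sub hR₀, Real.rpow_mul hR₀.le ϖ, Real.rpow_natCast, mul_comm 2,
          Real.rpow_mul hR₀.le, Real.rpow_add hR₀, Real.rpow_natCast, Real.rpow_two, inv_pow]
        ring
    _ ≤ C := mul_le_of_le_one_right hC (Real.rpow_le_one_of_one_le_of_nonpos hR hexponent)

theorem exists_dyadicKernel_noncritical_bound (hϖ : 2 ≤ ϖ) (M : ℝ) :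
    ∃ C : ℝ, 0 ≤ C ∧ ∀ η ∈ Set.Icc 0 M, ∀ R : ℝ, 1 ≤ R → ∀ x : EuclideanSpace ℝ (Fin d),
      Noncritical ϖ (R ^ (1 - ϖ) * ‖x‖) → ‖dyadicKernel ϖ η R x‖ ≤ C * R⁻¹ := by
  obtain ⟨N, hN⟩ := exists_nat_ge (d + M + 1)
  obtain ⟨C, hC, hbound⟩ := exists_annulusIntegral_noncritical_bound
    (V := EuclideanSpace ℝ (Fin d)) hϖ M N
  refine ⟨C, hC, fun η hη R hR x hx => ?_⟩
  have hR₀ : 0 < R := by linarith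
  have hexponent : d + η - ϖ * N ≤ -1 := by
    nlinarith [hη.2, mul_le_mul_of_nonneg_right hϖ N.cast_nonneg]
  have hnorm : ‖R ^ (1 - ϖ) • x‖ = R ^ (1 - ϖ) * ‖x‖ := by
    rw [norm_smul, Real.norm_of_nonneg (by positivity)]
  rw [dyadicKernel_eq hR₀, norm_mul, Complex.norm_real, Real.norm_of_nonneg (by positivity)]
  calc R ^ d * R ^ η * ‖annulusIntegral ϖ η (R ^ ϖ) (R ^ (1 - ϖ) • x)‖
      ≤ R ^ d * R ^ η * (C * (R ^ ϖ)⁻¹ ^ N) := by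
        gcongr
        exact hbound η hη _ (by positivity) _ (by rwa [hnorm])
    _ = C * R ^ (d + η - ϖ * N) := by
        rw [Real.rpow_sub hR₀, Real.rpow_mul hR₀.le ϖ, Real.rpow_natCast, Real.rpow_add hR₀,
          Real.rpow_natCast, inv_pow]
        ring
    _ ≤ C * R⁻¹ := by
        rw [← Real.rpow_neg_one]
        gcongr

theorem Noncritical.of_mul {q r : ℝ} (hq : q ≤ (2 ^ (2 * ϖ))⁻¹)
    (hr : 0 ≤ r) (h : ¬ Noncritical ϖ r) : Noncritical ϖ (q * r) := by
  rw [Noncritical, not_or, not_le, not_le] at h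
  refine .inl ?_
  calc q * r ≤ (2 ^ (2 * ϖ))⁻¹ * (ϖ * 2 ^ ϖ) := mul_le_mul hq h.2.le hr (by positivity)
    _ = ϖ * (1 / 2) ^ ϖ := by
      rw [two_mul, Real.rpow_add two_pos, one_div, Real.inv_rpow zero_le_two]
      field_simp

theorem noncritical_of_add_four_le (hϖ : 2 ≤ ϖ) {r : ℝ} (hr : 0 ≤ r) {j k : ℕ} (hjk : j + 4 ≤ k)
    (hj : ¬ Noncritical ϖ (((2 : ℝ) ^ j) ^ (1 - ϖ) * r)) :
    Noncritical ϖ (((2 : ℝ) ^ k) ^ (1 - ϖ) * r) := by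
  obtain ⟨n, rfl⟩ := Nat.exists_eq_add_of_le hjk
  have hratio : ((2 : ℝ) ^ (4 + n)) ^ (1 - ϖ) ≤ (2 ^ (2 * ϖ))⁻¹ := by
    rw [← Real.rpow_natCast, ← Real.rpow_mul zero_le_two, ← Real.rpow_neg zero_le_two]
    refine Real.rpow_le_rpow_of_exponent_le one_le_two ?_
    push_cast
    nlinarith [(Nat.cast_nonneg n : (0 : ℝ) ≤ n)]
  rw [add_assoc, pow_add, mul_comm ((2 : ℝ) ^ j), Real.mul_rpow (by positivity) (by positivity),
    mul_assoc]
  exact .of_mul hratio (by positivity) hj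

theorem exists_critical_window (hϖ : 2 ≤ ϖ) {r : ℝ} (hr : 0 ≤ r) :
    ∃ k, ∀ j ∉ Finset.Ico k (k + 4), Noncritical ϖ (((2 : ℝ) ^ (j + 1)) ^ (1 - ϖ) * r) := by
  classical
  by_cases h : ∃ j : ℕ, ¬ Noncritical ϖ (((2 : ℝ) ^ (j + 1)) ^ (1 - ϖ) * r)
  · refine ⟨Nat.find h, fun j hj => ?_⟩
    rw [Finset.mem_Ico, not_and_or, not_le, not_lt] at hj
    rcases hj with hj | hj
    · exact not_not.1 (Nat.find_min h hj)
    · exact noncritical_of_add_four_le hϖ hr (by lia) (Nat.find_spec h)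
  · exact ⟨0, fun j _ => not_not.1 (not_exists.1 h j)⟩

theorem eventually_noncritical (hϖ : 1 < ϖ) (r : ℝ) :
    ∀ᶠ j : ℕ in atTop, ∀ x ∈ Metric.ball (0 : EuclideanSpace ℝ (Fin d)) r,
      Noncritical ϖ (((2 : ℝ) ^ (j + 1)) ^ (1 - ϖ) * ‖x‖) := by
  have hlim : Tendsto (fun j : ℕ => ((2 : ℝ) ^ (j + 1)) ^ (1 - ϖ) * r) atTop (𝓝 0) := by
    have hpow := (tendsto_pow_atTop_atTop_of_one_lt (one_lt_two (α := ℝ))).comp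
      (tendsto_add_atTop_nat 1)
    simpa using ((tendsto_rpow_neg_atTop (sub_pos.2 hϖ)).comp hpow).mul_const r
  filter_upwards [hlim.eventually_lt_const (show 0 < ϖ * (1 / 2) ^ ϖ by positivity)] with j hj x hx
  refine .inl (le_trans ?_ hj.le)
  gcongr
  exact (mem_ball_zero_iff.1 hx).le

end DyadicPieces

section Kernel

variable {d : ℕ} {ϖ η : ℝ}

/-- The symbol at time `1`, cut off to the ball of radius `2 ^ (J + 1)`. -/
noncomputable def truncSymbol (ϖ η : ℝ) (J : ℕ) (ξ : EuclideanSpace ℝ (Fin d)) : ℂ :=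
  dispSymbol ϖ η 1 ξ * (ballCutoff (EuclideanSpace ℝ (Fin d)) (((2 : ℝ) ^ J)⁻¹ • ξ) : ℝ)

theorem truncSymbol_of_ge {J : ℕ} {ξ : EuclideanSpace ℝ (Fin d)} (h : 2 ^ J * 2 ≤ ‖ξ‖) :
    truncSymbol ϖ η J ξ = 0 := by
  rw [truncSymbol, ballCutoff_of_ge, Complex.ofReal_zero, mul_zero]
  rwa [norm_smul, norm_inv, norm_pow, Real.norm_ofNat, le_inv_mul_iff₀ (by positivity)]

theorem truncSymbol_of_le {J : ℕ} {ξ : EuclideanSpace ℝ (Fin d)} (h : ‖ξ‖ ≤ 2 ^ J) :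
    truncSymbol ϖ η J ξ = dispSymbol ϖ η 1 ξ := by
  rw [truncSymbol, ballCutoff_of_le, Complex.ofReal_one, mul_one]
  rwa [norm_smul, norm_inv, norm_pow, Real.norm_ofNat, inv_mul_le_one₀ (by positivity)]

theorem integrable_truncSymbol (hϖ : 0 ≤ ϖ) (hη : 0 ≤ η) (J : ℕ) :
    Integrable (truncSymbol ϖ η J : EuclideanSpace ℝ (Fin d) → ℂ) := by
  refine Continuous.integrable_of_hasCompactSupport ?_
    (.intro (isCompact_closedBall 0 (2 ^ J * 2)) fun ξ hξ => truncSymbol_of_ge ?_)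
  · exact (continuous_dispSymbol hϖ hη 1).mul (Complex.continuous_ofReal.comp
      ((ballCutoff _).continuous.comp (continuous_const_smul _)))
  · rw [mem_closedBall_zero_iff, not_le] at hξ
    exact hξ.le

theorem norm_truncSymbol_le (ϖ η : ℝ) (J : ℕ) (ξ : EuclideanSpace ℝ (Fin d)) :
    ‖truncSymbol ϖ η J ξ‖ ≤ ‖dispSymbol ϖ η 1 ξ‖ := by
  rw [truncSymbol, norm_mul, Complex.norm_real, Real.norm_of_nonneg (ballCutoff _).nonneg]
  exact mul_le_of_le_one_right (norm_nonneg _) (ballCutoff _).le_one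

theorem tendsto_truncSymbol (ϖ η : ℝ) (ξ : EuclideanSpace ℝ (Fin d)) :
    Tendsto (fun J => truncSymbol ϖ η J ξ) atTop (𝓝 (dispSymbol ϖ η 1 ξ)) := by
  refine tendsto_const_nhds.congr' ?_
  filter_upwards [(tendsto_pow_atTop_atTop_of_one_lt
    (one_lt_two (α := ℝ))).eventually_ge_atTop ‖ξ‖] with J hJ using (truncSymbol_of_le hJ).symm

theorem truncSymbol_succ_sub (ϖ η : ℝ) (J : ℕ) (ξ : EuclideanSpace ℝ (Fin d)) :
    truncSymbol ϖ η (J + 1) ξ - truncSymbol ϖ η J ξ =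
      dispSymbol ϖ η 1 ξ * (annulusCutoff (((2 : ℝ) ^ (J + 1))⁻¹ • ξ) : ℝ) := by
  have hscale : (2 : ℝ) • ((2 : ℝ) ^ (J + 1))⁻¹ • ξ = ((2 : ℝ) ^ J)⁻¹ • ξ := by
    rw [smul_smul, pow_succ', mul_inv, mul_inv_cancel_left₀ two_ne_zero]
  rw [truncSymbol, truncSymbol, annulusCutoff, hscale]
  push_cast
  ring

theorem invFourier_truncSymbol (hϖ : 0 ≤ ϖ) (hη : 0 ≤ η) (J : ℕ)
    (x : EuclideanSpace ℝ (Fin d)) :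
    invFourier (truncSymbol ϖ η J) x = invFourier (truncSymbol ϖ η 0) x +
      ∑ j ∈ Finset.range J, dyadicKernel ϖ η (2 ^ (j + 1)) x := by
  have hstep (j : ℕ) : dyadicKernel ϖ η (2 ^ (j + 1)) x =
      invFourier (truncSymbol ϖ η (j + 1)) x - invFourier (truncSymbol ϖ η j) x := by
    rw [← invFourier_sub (integrable_truncSymbol hϖ hη _) (integrable_truncSymbol hϖ hη _),
      dyadicKernel]
    exact congrArg (invFourier · x) (funext fun ξ => (truncSymbol_succ_sub ϖ η j ξ).symm)
  simp only [hstep]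
  rw [Finset.sum_range_sub (fun j => invFourier (truncSymbol ϖ η j) x), add_sub_cancel]

theorem norm_invFourier_truncSymbol_zero_le {M : ℝ} (hη : η ∈ Set.Icc 0 M)
    (x : EuclideanSpace ℝ (Fin d)) :
    ‖invFourier (truncSymbol ϖ η 0) x‖ ≤
      2 ^ M * (volume : Measure (EuclideanSpace ℝ (Fin d))).real (Metric.closedBall 0 2) := by
  have hsupp : ∀ ξ ∉ Metric.closedBall (0 : EuclideanSpace ℝ (Fin d)) 2,
      expI (inner ℝ ξ x) * truncSymbol ϖ η 0 ξ = 0 := fun ξ hξ => by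
    rw [mem_closedBall_zero_iff, not_le] at hξ
    rw [truncSymbol_of_ge (by linarith), mul_zero]
  rw [invFourier_apply, ← setIntegral_eq_integral_of_forall_compl_eq_zero hsupp]
  refine norm_setIntegral_le_of_norm_le_const measure_closedBall_lt_top fun ξ hξ => ?_
  calc ‖expI (inner ℝ ξ x) * truncSymbol ϖ η 0 ξ‖ ≤ ‖ξ‖ ^ η := by
        rw [norm_mul, norm_expI, one_mul, ← norm_dispSymbol ϖ η 1]
        exact norm_truncSymbol_le ϖ η 0 ξ
    _ ≤ 2 ^ η := Real.rpow_le_rpow (norm_nonneg _) (mem_closedBall_zero_iff.1 hξ) hη.1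
    _ ≤ 2 ^ M := Real.rpow_le_rpow_of_exponent_le one_le_two hη.2

theorem hasSum_inv_two_pow_succ : HasSum (fun j : ℕ => ((2 : ℝ) ^ (j + 1))⁻¹) 1 := by
  simpa [pow_succ, mul_inv, div_eq_mul_inv] using hasSum_geometric_two' 1

theorem sum_range_le_of_window {a : ℕ → ℝ} {A B : ℝ} {k l : ℕ} (hA : 0 ≤ A) (hB : 0 ≤ B)
    (ha : ∀ j, a j ≤ A) (ha' : ∀ j ∉ Finset.Ico k (k + l), a j ≤ B * ((2 : ℝ) ^ (j + 1))⁻¹)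
    (J : ℕ) : ∑ j ∈ Finset.range J, a j ≤ l * A + B := by
  have hterm (j : ℕ) :
      a j ≤ (if j ∈ Finset.Ico k (k + l) then A else 0) + B * ((2 : ℝ) ^ (j + 1))⁻¹ := by
    split_ifs with hj
    · exact (ha j).trans (le_add_of_nonneg_right (by positivity))
    · simpa using ha' j hj
  have hwindow : ∑ j ∈ Finset.range J, (if j ∈ Finset.Ico k (k + l) then A else 0) ≤ l * A := by
    rw [Finset.sum_ite_mem, Finset.sum_const, nsmul_eq_mul]
    gcongr
    simpa using Finset.card_le_card
      (Finset.inter_subset_right (s₁ := Finset.range J) (s₂ := Finset.Ico k (k + l)))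
  calc ∑ j ∈ Finset.range J, a j
      ≤ ∑ j ∈ Finset.range J, ((if j ∈ Finset.Ico k (k + l) then A else 0) +
          B * ((2 : ℝ) ^ (j + 1))⁻¹) := Finset.sum_le_sum fun j _ => hterm j
    _ ≤ l * A + B * 1 := by
        rw [Finset.sum_add_distrib, ← Finset.mul_sum]
        gcongr
        exact sum_le_hasSum _ (fun j _ => by positivity) hasSum_inv_two_pow_succ
    _ = l * A + B := by rw [mul_one]

theorem exists_invFourier_truncSymbol_bound [NeZero d] (hϖ : 2 ≤ ϖ) :
    ∃ C : ℝ, ∀ η ∈ Set.Icc 0 (d * (ϖ / 2 - 1)), ∀ (J : ℕ) (x : EuclideanSpace ℝ (Fin d)),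
      ‖invFourier (truncSymbol ϖ η J) x‖ ≤ C := by
  obtain ⟨A, hA, hbound⟩ := exists_dyadicKernel_bound (d := d) hϖ
  obtain ⟨B, hB, hdecay⟩ := exists_dyadicKernel_noncritical_bound (d := d) hϖ (d * (ϖ / 2 - 1))
  refine ⟨2 ^ (d * (ϖ / 2 - 1)) *
    (volume : Measure (EuclideanSpace ℝ (Fin d))).real (Metric.closedBall 0 2) +
    ((4 : ℕ) * A + B), fun η hη J x => ?_⟩
  have hone (j : ℕ) : (1 : ℝ) ≤ 2 ^ (j + 1) := one_le_pow₀ one_le_two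
  obtain ⟨k, hk⟩ := exists_critical_window hϖ (norm_nonneg x)
  rw [invFourier_truncSymbol (by linarith) hη.1]
  refine norm_add_le_of_le (norm_invFourier_truncSymbol_zero_le hη x)
    ((norm_sum_le _ _).trans (sum_range_le_of_window hA hB (fun j => hbound η hη _ (hone j) x)
      (fun j hj => hdecay η hη _ (hone j) x (hk j hj)) J))

/-- The kernel at time `1`, as the sum of its Littlewood–Paley pieces. -/
noncomputable def dispersiveKernel (ϖ η : ℝ) (x : EuclideanSpace ℝ (Fin d)) : ℂ :=
  invFourier (truncSymbol ϖ η 0) x + ∑' j : ℕ, dyadicKernel ϖ η (2 ^ (j + 1)) x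

theorem tendstoLocallyUniformly_dispersiveKernel (hϖ : 2 ≤ ϖ) (hη : 0 ≤ η) :
    TendstoLocallyUniformly
      (fun J => invFourier (truncSymbol ϖ η J : EuclideanSpace ℝ (Fin d) → ℂ))
      (dispersiveKernel ϖ η) atTop := by
  obtain ⟨B, -, hdecay⟩ := exists_dyadicKernel_noncritical_bound (d := d) hϖ η
  refine tendstoLocallyUniformly_of_forall_exists_nhds fun x =>
    ⟨Metric.ball 0 (‖x‖ + 1), Metric.isOpen_ball.mem_nhds (by simp), ?_⟩
  have hseries : TendstoUniformlyOn
      (fun J (x : EuclideanSpace ℝ (Fin d)) =>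
        ∑ j ∈ Finset.range J, dyadicKernel ϖ η (2 ^ (j + 1)) x)
      (fun x => ∑' j : ℕ, dyadicKernel ϖ η (2 ^ (j + 1)) x) atTop (Metric.ball 0 (‖x‖ + 1)) := by
    refine tendstoUniformlyOn_tsum_nat_eventually (hasSum_inv_two_pow_succ.summable.mul_left B) ?_
    filter_upwards [eventually_noncritical (show 1 < ϖ by linarith) (‖x‖ + 1)] with j hj y hy
    exact hdecay η ⟨hη, le_rfl⟩ _ (one_le_pow₀ one_le_two) y (hj y hy)
  rw [Metric.tendstoUniformlyOn_iff] at hseries ⊢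
  intro ε hε
  filter_upwards [hseries ε hε] with J hJ y hy
  rw [dispersiveKernel, invFourier_truncSymbol (by linarith) hη J, dist_add_left]
  exact hJ y hy

theorem tendsto_dispersiveKernel (hϖ : 2 ≤ ϖ) (hη : 0 ≤ η) (x : EuclideanSpace ℝ (Fin d)) :
    Tendsto (fun J => invFourier (truncSymbol ϖ η J) x) atTop (𝓝 (dispersiveKernel ϖ η x)) :=
  (tendstoLocallyUniformly_dispersiveKernel hϖ hη).tendstoLocallyUniformlyOn.tendsto_at
    (Set.mem_univ x)

theorem continuous_dispersiveKernel (hϖ : 2 ≤ ϖ) (hη : 0 ≤ η) :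
    Continuous (dispersiveKernel ϖ η : EuclideanSpace ℝ (Fin d) → ℂ) :=
  (tendstoLocallyUniformly_dispersiveKernel hϖ hη).continuous <| .of_forall fun J =>
    continuous_invFourier (integrable_truncSymbol (by linarith) hη J)

theorem norm_dispersiveKernel_le (hϖ : 2 ≤ ϖ) (hη : 0 ≤ η) {C : ℝ}
    (hC : ∀ (J : ℕ) (x : EuclideanSpace ℝ (Fin d)), ‖invFourier (truncSymbol ϖ η J) x‖ ≤ C)
    (x : EuclideanSpace ℝ (Fin d)) : ‖dispersiveKernel ϖ η x‖ ≤ C :=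
  le_of_tendsto (tendsto_dispersiveKernel hϖ hη x).norm (.of_forall fun J => hC J x)

theorem isWeakInvFourier_dispersiveKernel (hϖ : 2 ≤ ϖ) (hη : 0 ≤ η) {C : ℝ}
    (hC : ∀ (J : ℕ) (x : EuclideanSpace ℝ (Fin d)), ‖invFourier (truncSymbol ϖ η J) x‖ ≤ C) :
    IsWeakInvFourier (dispSymbol ϖ η 1 : EuclideanSpace ℝ (Fin d) → ℂ) (dispersiveKernel ϖ η) :=
  .of_tendsto (integrable_truncSymbol (by linarith) hη) (norm_truncSymbol_le ϖ η)
    (tendsto_truncSymbol ϖ η) hC (tendsto_dispersiveKernel hϖ hη)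

theorem integrable_dispSymbol_mul_schwartz (hϖ : 0 ≤ ϖ) (hη : 0 ≤ η) (t : ℝ)
    (χ : 𝓢(EuclideanSpace ℝ (Fin d), ℂ)) : Integrable fun ξ => dispSymbol ϖ η t ξ * χ ξ := by
  obtain ⟨n, hn⟩ := exists_nat_ge η
  refine (χ.integrable.norm.add (χ.integrable_pow_mul volume n)).mono'
    ((continuous_dispSymbol hϖ hη t).mul χ.continuous).aestronglyMeasurable
    (.of_forall fun ξ => ?_)
  have hpow : ‖ξ‖ ^ η ≤ 1 + ‖ξ‖ ^ n := by
    rcases le_total ‖ξ‖ 1 with h | h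
    · exact (Real.rpow_le_one (norm_nonneg ξ) h hη).trans (le_add_of_nonneg_right (by positivity))
    · rw [← Real.rpow_natCast]
      exact (Real.rpow_le_rpow_of_exponent_le h hn).trans (le_add_of_nonneg_left zero_le_one)
  calc ‖dispSymbol ϖ η t ξ * χ ξ‖ ≤ (1 + ‖ξ‖ ^ n) * ‖χ ξ‖ := by
        rw [norm_mul, norm_dispSymbol]
        gcongr
    _ = ‖χ ξ‖ + ‖ξ‖ ^ n * ‖χ ξ‖ := by ring

theorem IsWeakInvFourier.isDispersiveKernel {t C : ℝ} {K : EuclideanSpace ℝ (Fin d) → ℂ}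
    (h : IsWeakInvFourier (dispSymbol ϖ η t) K) (hϖ : 0 ≤ ϖ) (hη : 0 ≤ η) (hK : Continuous K)
    (hC : ∀ x, ‖K x‖ ≤ C) : IsDispersiveKernel d ϖ η t K := by
  have hm := integrable_dispSymbol_mul_schwartz (d := d) hϖ hη t
  refine ⟨fun x => ?_, h.isInvFourierTransform hm hK hC⟩
  have hosc := (h.modulate x).hasOscillatoryIntegral (fun χ => ?_)
    (hK.comp (continuous_const_add x)) (fun _ => hC _)
  · have hsymbol (ξ : EuclideanSpace ℝ (Fin d)) : expI (inner ℝ x ξ) * dispSymbol ϖ η t ξ =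
        expI (t * ‖ξ‖ ^ ϖ + inner ℝ x ξ) * (‖ξ‖ ^ η : ℝ) := by
      rw [add_comm, expI_add, dispSymbol, mul_assoc]
    simp only [hsymbol, add_zero] at hosc
    exact hosc
  · simpa only [mul_assoc] using integrable_expI_mul (by fun_prop) (hm χ)

theorem IsWeakInvFourier.rescale {K : EuclideanSpace ℝ (Fin d) → ℂ}
    (h : IsWeakInvFourier (dispSymbol ϖ η 1) K) (hϖ : 0 < ϖ) {t : ℝ} (ht : 0 < t) :
    IsWeakInvFourier (dispSymbol ϖ η t)
      fun x => (t ^ (-(d + η) / ϖ) : ℝ) * K (t ^ (-1 / ϖ) • x) := by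
  set s := t ^ (-1 / ϖ) with hs
  have hs₀ : 0 < s := by positivity
  have htime : 1 * s⁻¹ ^ ϖ = t := by
    rw [one_mul, hs, ← Real.rpow_neg ht.le, ← Real.rpow_mul ht.le, neg_div, neg_neg,
      one_div_mul_cancel hϖ.ne', Real.rpow_one]
  have hfactor : t ^ (-(d + η) / ϖ) = s ^ η * s ^ d := by
    rw [← Real.rpow_natCast, ← Real.rpow_add hs₀, hs, ← Real.rpow_mul ht.le]
    congr 1
    ring
  have hdilate := (h.comp_inv_smul hs₀).const_mul (c := (s ^ η : ℝ))
    (Complex.ofReal_ne_zero.2 (by positivity))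
  have hsymbol (ξ : EuclideanSpace ℝ (Fin d)) :
      (s ^ η : ℝ) * dispSymbol ϖ η 1 (s⁻¹ • ξ) = dispSymbol ϖ η t ξ := by
    rw [dispSymbol_smul (by positivity), htime, ← mul_assoc, ← Complex.ofReal_mul,
      ← Real.mul_rpow hs₀.le (by positivity), mul_inv_cancel₀ hs₀.ne', Real.one_rpow,
      Complex.ofReal_one, one_mul]
  simp only [hsymbol, ← mul_assoc, ← Complex.ofReal_mul, ← hfactor] at hdilate
  exact hdilate

end Kernel

theorem lemma3p6 (d : ℕ) (hd : 1 ≤ d) (ϖ : ℝ) (hϖ : 2 ≤ ϖ) :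
    ∃ C : ℝ, ∀ η : ℝ, 0 ≤ η / (d : ℝ) → η / (d : ℝ) ≤ ϖ / 2 - 1 →
      ∃ K : EuclideanSpace ℝ (Fin d) → ℂ,
        IsDispersiveKernel d ϖ η 1 K ∧ (∀ x, ‖K x‖ ≤ C) ∧
        ∀ t : ℝ, 0 < t →
          ∃ Kt : EuclideanSpace ℝ (Fin d) → ℂ,
            IsDispersiveKernel d ϖ η t Kt ∧
            (∀ x, Kt x = ((t ^ (-((d : ℝ) + η) / ϖ) : ℝ) : ℂ) * K (t ^ (-1 / ϖ) • x)) ∧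
            ∀ x, ‖Kt x‖ ≤ C * t ^ (-((d : ℝ) + η) / ϖ) := by
  have hd₀ : (0 : ℝ) < d := by exact_mod_cast hd
  have : NeZero d := ⟨by lia⟩
  obtain ⟨C, hC⟩ := exists_invFourier_truncSymbol_bound (d := d) hϖ
  refine ⟨C, fun η hη₀ hη₁ => ?_⟩
  have hη : 0 ≤ η := by simpa [div_mul_cancel₀ _ hd₀.ne'] using mul_nonneg hη₀ hd₀.le
  replace hC := hC η ⟨hη, by rwa [div_le_iff₀' hd₀] at hη₁⟩
  have hcont := continuous_dispersiveKernel (d := d) hϖ hη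
  have hbound := norm_dispersiveKernel_le hϖ hη hC
  have hweak := isWeakInvFourier_dispersiveKernel hϖ hη hC
  refine ⟨dispersiveKernel ϖ η, hweak.isDispersiveKernel (by linarith) hη hcont hbound, hbound,
    fun t ht => ?_⟩
  have hbound_t (x : EuclideanSpace ℝ (Fin d)) :
      ‖((t ^ (-((d : ℝ) + η) / ϖ) : ℝ) : ℂ) * dispersiveKernel ϖ η (t ^ (-1 / ϖ) • x)‖ ≤
        C * t ^ (-((d : ℝ) + η) / ϖ) := by
    rw [norm_mul, Complex.norm_real, Real.norm_of_nonneg (by positivity), mul_comm]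
    exact mul_le_mul_of_nonneg_right (hbound _) (by positivity)
  exact ⟨_, (hweak.rescale (by linarith) ht).isDispersiveKernel (by linarith) hη
    (continuous_const.mul (hcont.comp (continuous_const_smul _))) hbound_t, fun _ => rfl, hbound_t⟩
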